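/- Let $M$ be a complex manifold (Hausdorff, second countable, of dimension $n$) with a holomorphic Riemannian metric $g$, that is, a holomorphic field of symmetric non-degenerate complex bilinear forms on the tangent spaces. Let $P\subset M$ be a generic real slice: an embedded real-analytic submanifold such that, for every $p\in P$, the form $g$ is real valued and non-degenerate on $T_pP$, and $T_pP+i\,T_pP=T_pM$. Let $Q\subset P$ be an embedded real-analytic submanifold that is pseudo-Riemannian ($g$ is non-degenerate on each $T_yQ$). Submanifolds are embedded. A *complexification* of an embedded real-analytic submanifold $S\subset P$ in $M$ is an embedded complex submanifold $X\subset M$ that contains $S$ as an embedded real-analytic submanifold with $T_xX=T_xS\oplus i\,T_xS$ for all $x\in S$; we write $X=\mathbb{C}S$. Let $F$ be a real-analytic tensor field defined along an embedded real-analytic submanifold $S$ with $Q\subset S\subset P$ (for example $S=P$, a tensor field on $P$, or $S=Q$, a tensor field along $Q$ such as the second fundamental form or the mean curvature vector). It may be of mixed type: $F_x$ is a real multilinear map which takes $a$ vectors and $b$ covectors of $T_xS$, and $c$ vectors and $d$ covectors of $T_xP$. A *holomorphic extension* $\mathbb{C}F$ of $F$ to a complexification $X=\mathbb{C}S\subset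 M$ is a holomorphic tensor field along $X$, of type $(a,b)$ over $TX$ and $(c,d)$ over $TM|_X$, whose value at each $x\in S$ is the complex multilinear extension of $F_x$ under the identifications $T_xS\otimes\mathbb{C}=T_xX$ and $T_xP\otimes\mathbb{C}=T_xM$. Suppose that $F_y=0$ for all $y\in Q$. Then 1. there are a complexification $\mathbb{C}S\subset M$ of $S$ and a holomorphic extension $\mathbb{C}F$ of $F$ to $\mathbb{C}S$; and 2. for every complexification $\mathbb{C}S\subset M$ of $S$ and every holomorphic extension $\mathbb{C}F$ of $F$ to $\mathbb{C}S$, there is a complexification $N=\mathbb{C}Q\subset M$ of $Q$, contained in $\mathbb{C}S$ as a complex submanifold, such that $\mathbb{C}F$ vanishes at every point of $N$. -/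

import Mathlib

open scoped Manifold ContDiff Pointwise

noncomputable section

namespace HolRiem

/-- The model space `ℝᵏ` of `k`-dimensional real manifolds. -/
abbrev RModel (k : ℕ) : Type := EuclideanSpace ℝ (Fin k)

/-- The model space `ℂᵏ` of `k`-dimensional complex manifolds. A complex manifold is a charted space
over `CModel k` which is `IsManifold 𝓘(ℂ, CModel k) ω`; the same charts are used, with the model
`𝓘(ℝ, CModel k)`, when it is regarded as a real-analytic manifold of dimension `2k`. -/
abbrev CModel (k : ℕ) : Type := EuclideanSpace ℂ (Fin k)

/-! ### Linear algebra -/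

section LinearAlgebra

variable {V : Type*} [NormedAddCommGroup V] [NormedSpace ℂ V]

/-- A real subspace `W` of a complex vector space is totally real if `W ∩ iW = 0`. -/
def IsTotallyReal (W : Submodule ℝ V) : Prop := W ⊓ Complex.I • W = ⊥

/-- A real subspace `W` of a complex vector space is generic if `W + iW` is the whole space. -/
def IsGeneric (W : Submodule ℝ V) : Prop := W ⊔ Complex.I • W = ⊤

/-- The restriction of a complex bilinear form to a real subspace is non-degenerate. -/
def IsNondegenerateOn (B : V →L[ℂ] V →L[ℂ] ℂ) (W : Submodule ℝ V) : Prop :=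
  ∀ x ∈ W, (∀ y ∈ W, B x y = 0) → x = 0

/-- A real slice: a real subspace on which the complex bilinear form is real valued and
non-degenerate. -/
def IsRealSlice (B : V →L[ℂ] V →L[ℂ] ℂ) (W : Submodule ℝ V) : Prop :=
  (∀ x ∈ W, ∀ y ∈ W, (B x y).im = 0) ∧ IsNondegenerateOn B W

end LinearAlgebra

/-- The `𝕜`-multilinear maps with values in `𝕜` that take `a` vectors of `A`, `b` covectors of `A`,
`c` vectors of `B` and `d` covectors of `B`, that is, the mixed tensors of type `(a, b)` over `A`
and of type `(c, d)` over `B`. -/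
abbrev MixedTensor (𝕜 A B : Type*) [Field 𝕜] [AddCommGroup A] [Module 𝕜 A]
    [AddCommGroup B] [Module 𝕜 B] (a b c d : ℕ) : Type _ :=
  MultilinearMap 𝕜 (fun _ : Fin a => A)
    (MultilinearMap 𝕜 (fun _ : Fin b => Module.Dual 𝕜 A)
      (MultilinearMap 𝕜 (fun _ : Fin c => B)
        (MultilinearMap 𝕜 (fun _ : Fin d => Module.Dual 𝕜 B) 𝕜)))

/-! ### Tensor fields along a map -/

section TensorFields

variable {𝕜 : Type*} [NontriviallyNormedField 𝕜]
  {A : Type*} [NormedAddCommGroup A] [NormedSpace 𝕜 A]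
  {B : Type*} [NormedAddCommGroup B] [NormedSpace 𝕜 B]
  {S : Type*} [TopologicalSpace S] [ChartedSpace A S]
  {Y : Type*} [TopologicalSpace Y] [ChartedSpace B Y]

/-- A mixed tensor field along a map `f : S → Y`: at each point `x` of `S` a tensor of type `(a, b)`
over `T_x S` and of type `(c, d)` over `T_{f x} Y`. -/
abbrev TensorFieldAlong (𝕜 : Type*) [NontriviallyNormedField 𝕜]
    (A : Type*) [NormedAddCommGroup A] [NormedSpace 𝕜 A]
    (B : Type*) [NormedAddCommGroup B] [NormedSpace 𝕜 B]
    {S : Type*} [TopologicalSpace S] [ChartedSpace A S]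
    {Y : Type*} [TopologicalSpace Y] [ChartedSpace B Y]
    (f : S → Y) (a b c d : ℕ) : Type _ :=
  ∀ x : S, MixedTensor 𝕜 (TangentSpace 𝓘(𝕜, A) x) (TangentSpace 𝓘(𝕜, B) (f x)) a b c d

/-- A tensor field along `f` is analytic (real-analytic for `𝕜 = ℝ`, holomorphic for `𝕜 = ℂ`) if
its components with respect to the coordinate frames of charts of `S` and `Y` are analytic. -/
def TensorFieldAlong.IsAnalytic [IsManifold 𝓘(𝕜, A) ω S] [IsManifold 𝓘(𝕜, B) ω Y]
    {f : S → Y} {a b c d : ℕ} (F : TensorFieldAlong 𝕜 A B f a b c d) : Prop :=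
  ∀ (x₀ : S) (u : Fin a → A) (l : Fin b → Module.Dual 𝕜 A)
    (v : Fin c → B) (m : Fin d → Module.Dual 𝕜 B),
    ContMDiffAt 𝓘(𝕜, A) 𝓘(𝕜, 𝕜) ω (fun x : S =>
      F x
        (fun i => (trivializationAt A (TangentSpace 𝓘(𝕜, A)) x₀).symmL 𝕜 x (u i))
        (fun i => (l i).comp
          ((trivializationAt A (TangentSpace 𝓘(𝕜, A)) x₀).continuousLinearMapAt 𝕜 x).toLinearMap)
        (fun i => (trivializationAt B (TangentSpace 𝓘(𝕜, B)) (f x₀)).symmL 𝕜 (f x) (v i))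
        (fun i => (m i).comp
          ((trivializationAt B (TangentSpace 𝓘(𝕜, B)) (f x₀)).continuousLinearMapAt 𝕜
            (f x)).toLinearMap)) x₀

end TensorFields

/-! ### Real submanifolds of complex manifolds and complexifications -/

section Submanifolds

variable (s m : ℕ)
  {S : Type*} [TopologicalSpace S] [ChartedSpace (RModel s) S]
  {X : Type*} [TopologicalSpace X] [ChartedSpace (CModel s) X]
  {M : Type*} [TopologicalSpace M] [ChartedSpace (CModel m) M]

/-- The real differential at `x` of a map from a real manifold to a complex manifold; the tangent
space of the target is its model `CModel m`, which is both a real and a complex vector space. -/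
def realDifferential (f : S → M) (x : S) : RModel s →L[ℝ] CModel m :=
  mfderiv (𝓡 s) 𝓘(ℝ, CModel m) f x

/-- The image of `T_x S` in the tangent space of `M` at `f x`, as a real subspace. -/
def tangentImage (f : S → M) (x : S) : Submodule ℝ (CModel m) :=
  (realDifferential s m f x).range

/-- Let `f : S → M` be the inclusion of a real submanifold `S` in the complex manifold `M`. The
complex manifold `X`, together with `κ : X → M` and `j : S → X`, is a complexification of `S` in `M`:
`κ` makes `X` an embedded complex submanifold of `M`, it contains `S` through `j`, and `S` is a
generic totally real real-analytic submanifold of `X`. -/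
structure IsComplexification (f : S → M) (j : S → X) (κ : X → M) : Prop where
  isHolomorphicEmbedding : Manifold.IsSmoothEmbedding 𝓘(ℂ, CModel s) 𝓘(ℂ, CModel m) ω κ
  isAnalyticEmbedding : Manifold.IsSmoothEmbedding (𝓡 s) 𝓘(ℝ, CModel s) ω j
  comp_eq : ∀ x, κ (j x) = f x
  isTotallyReal : ∀ x, IsTotallyReal (tangentImage s s j x)
  isGeneric : ∀ x, IsGeneric (tangentImage s s j x)

/-- Let `S ⊆ P ⊆ M` with `P` and `S` real, `M` complex, and let `κ : X → M` be a complexification of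
`S` in `M`, with `j : S → X`. The tensor field `G` along `κ` extends the real tensor field `F` along
the inclusion `ιS : S → P`: under the identifications of `T_x S ⊗ ℂ` with `T_{j x} X` and of
`T_x P ⊗ ℂ` with `T_x M`, the value of `G` at `j x` is the complex multilinear extension of `F` at
`x`. Here the complex covectors `L i`, `N i` are the complex linear extensions of the real covectors
`l i`, `m i`. -/
def Extends (p : ℕ) {P : Type*} [TopologicalSpace P] [ChartedSpace (RModel p) P]
    {ιS : S → P} {κ : X → M} (ιP : P → M) (j : S → X) {a b c d : ℕ}
    (G : TensorFieldAlong ℂ (CModel s) (CModel m) κ a b c d)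
    (F : TensorFieldAlong ℝ (RModel s) (RModel p) ιS a b c d) : Prop :=
  ∀ (x : S) (u : Fin a → RModel s) (l : Fin b → Module.Dual ℝ (RModel s))
    (v : Fin c → RModel p) (m' : Fin d → Module.Dual ℝ (RModel p))
    (L : Fin b → Module.Dual ℂ (CModel s)) (N : Fin d → Module.Dual ℂ (CModel m)),
    (∀ i w, L i (realDifferential s s j x w) = (l i w : ℂ)) →
    (∀ i w, N i (realDifferential p m ιP (ιS x) w) = (m' i w : ℂ)) →
    G (j x) (fun i => realDifferential s s j x (u i)) L
      (fun i => realDifferential p m ιP (ιS x) (v i)) N = ((F x u l v m' : ℝ) : ℂ)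

end Submanifolds

/-! ### Holomorphic Riemannian metrics -/

/-- A holomorphic Riemannian metric on a complex manifold: a holomorphic field of symmetric,
non-degenerate complex bilinear forms on the tangent spaces. -/
structure HolomorphicMetric (n : ℕ) (M : Type*) [TopologicalSpace M]
    [ChartedSpace (CModel n) M] [IsManifold 𝓘(ℂ, CModel n) ω M] where
  toFun : ∀ x : M, TangentSpace 𝓘(ℂ, CModel n) x →L[ℂ] TangentSpace 𝓘(ℂ, CModel n) x →L[ℂ] ℂ
  symm : ∀ x v w, toFun x v w = toFun x w v
  nondegenerate : ∀ x v, (∀ w, toFun x v w = 0) → v = 0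
  holomorphic : ContMDiff 𝓘(ℂ, CModel n)
    (𝓘(ℂ, CModel n).prod 𝓘(ℂ, CModel n →L[ℂ] CModel n →L[ℂ] ℂ)) ω
    (fun x => (Bundle.TotalSpace.mk' (CModel n →L[ℂ] CModel n →L[ℂ] ℂ) x (toFun x) :
      Bundle.TotalSpace (CModel n →L[ℂ] CModel n →L[ℂ] ℂ)
        (fun y : M => TangentSpace 𝓘(ℂ, CModel n) y →L[ℂ]
          TangentSpace 𝓘(ℂ, CModel n) y →L[ℂ] ℂ)))

/-- The metric at `x`, as a bilinear form on the model of the tangent space. -/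
def HolomorphicMetric.at {n : ℕ} {M : Type*} [TopologicalSpace M] [ChartedSpace (CModel n) M]
    [IsManifold 𝓘(ℂ, CModel n) ω M] (g : HolomorphicMetric n M) (x : M) :
    CModel n →L[ℂ] CModel n →L[ℂ] ℂ :=
  g.toFun x

/-- `ιP : P → M` is the inclusion of a generic real slice: `P` is an embedded real-analytic
submanifold all of whose tangent spaces are generic real slices. -/
structure IsGenericRealSlice (p : ℕ) {n : ℕ} {M : Type*} [TopologicalSpace M]
    [ChartedSpace (CModel n) M] [IsManifold 𝓘(ℂ, CModel n) ω M] (g : HolomorphicMetric n M)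
    {P : Type*} [TopologicalSpace P] [ChartedSpace (RModel p) P] (ιP : P → M) : Prop where
  isAnalyticEmbedding : Manifold.IsSmoothEmbedding (𝓡 p) 𝓘(ℝ, CModel n) ω ιP
  isRealSlice : ∀ x, IsRealSlice (g.at (ιP x)) (tangentImage p n ιP x)
  isGeneric : ∀ x, IsGeneric (tangentImage p n ιP x)

end HolRiem

end

open HolRiem

universe u

/-! The metric makes every tangent space of a generic real slice a real form. If `x = i y` with `x`,
`y` tangent to the slice, then `g(x, w) = i g(y, w)` is both real and imaginary for all tangent `w`,
so `x = 0` by non-degeneracy. Genericity gives the rest, so the complexified differential of the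
inclusion of `P` is bijective, and those of `S` and `Q` in `M` are injective.

Two local facts about `ℝᵏ ⊂ ℂᵏ` carry the argument. A real-analytic map extends holomorphically near
each real point, by complexifying its power series (`exists_holomorphic_extension`). A holomorphic
map that vanishes at the real points near a real point vanishes near it
(`eventually_eq_zero_of_real`). Combined with the inverse function theorem, the first fact yields
holomorphic charts in which a totally real submanifold is `ℝ^q ⊂ ℂ^q × 0 ⊂ ℂ^q × ℂ^r`
(`exists_isAdaptedAt`). Local complexifications and local extensions therefore exist, and by the
second fact their germs along the submanifold are unique.

Unique germs glue: `exists_glued_germ` turns local data with equal germs along a subset into one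
object on a neighbourhood of it. Applied to the predicate of lying on the local slice, it produces a
complexification (`exists_isSliced`). Applied to local tensor fields, it produces the holomorphic
extension (`exists_extension_near`), hence the first claim.

For the second claim, the extension vanishes on `Q`, because a complex multilinear extension at a
point is unique. The same construction inside the complexification of `S` gives a complex
submanifold `Y` in which `Q` is maximal totally real. The components of the extension are
holomorphic on `Y` and vanish on `Q`, hence near `Q` in `Y`, and `N` is the interior in `Y` of the
zero set (`exists_complexification_eq_zero`). -/

noncomputable section

namespace HolRiem

open Filter Topology

/-! ### Complexification of real analytic maps -/

section Flat

variable {k : ℕ} {E : Type*} [NormedAddCommGroup E] [NormedSpace ℂ E]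

/-- The inclusion of `ℝᵏ` in `ℂᵏ`. -/
def realIncl (k : ℕ) : RModel k →L[ℝ] CModel k :=
  LinearMap.toContinuousLinearMap
    { toFun := fun x => WithLp.toLp 2 fun i => (x i : ℂ)
      map_add' := fun x y => by ext i; simp
      map_smul' := fun c x => by ext i; simp }

@[simp] lemma realIncl_apply (x : RModel k) (i : Fin k) : realIncl k x i = (x i : ℂ) := rfl

/-- The real part of a vector of `ℂᵏ`. -/
def rePart (k : ℕ) : CModel k →L[ℝ] RModel k :=
  LinearMap.toContinuousLinearMap
    { toFun := fun z => WithLp.toLp 2 fun i => (z i).re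
      map_add' := fun x y => by ext i; simp
      map_smul' := fun c x => by ext i; simp }

@[simp] lemma rePart_apply (z : CModel k) (i : Fin k) : rePart k z i = (z i).re := rfl

lemma realIncl_re_add_im (z : CModel k) :
    realIncl k (rePart k z) + Complex.I • realIncl k (rePart k (-Complex.I • z)) = z := by
  ext i
  apply Complex.ext <;> simp

lemma realIncl_injective : Function.Injective (realIncl k) := fun x y h => by
  ext i
  have := congrArg (fun z : CModel k => z i) h
  simpa using this

/-- The complex linear extension of a real linear map from `ℝᵏ` to a complex vector space. -/
def cplx (T : RModel k →L[ℝ] E) : CModel k →L[ℂ] E :=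
  ∑ i, (EuclideanSpace.proj i : CModel k →L[ℂ] ℂ).smulRight (T (EuclideanSpace.single i 1))

lemma RModel.eq_sum (v : RModel k) : v = ∑ j, v j • EuclideanSpace.single j (1 : ℝ) := by
  ext i
  simp [Finset.sum_apply, Pi.single_apply]

@[simp] lemma cplx_realIncl (T : RModel k →L[ℝ] E) (v : RModel k) :
    cplx T (realIncl k v) = T v := by
  conv_rhs => rw [RModel.eq_sum v]
  simp [cplx, map_sum]

lemma cplx_apply (T : RModel k →L[ℝ] E) (z : CModel k) :
    cplx T z = T (rePart k z) + Complex.I • T (rePart k (-Complex.I • z)) := by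
  conv_lhs => rw [← realIncl_re_add_im z]
  rw [map_add, map_smul, cplx_realIncl, cplx_realIncl]

lemma clm_ext_real {f g : CModel k →L[ℂ] E} (h : ∀ v, f (realIncl k v) = g (realIncl k v)) :
    f = g := by
  ext1 z
  rw [← realIncl_re_add_im z]
  simp only [map_add, map_smul, h]

/-- The complex linear extension, as a continuous real linear map. -/
def cplxL (k m : ℕ) : (RModel k →L[ℝ] CModel m) →L[ℝ] (CModel k →L[ℂ] CModel m) :=
  LinearMap.toContinuousLinearMap
    { toFun := cplx
      map_add' := fun S T => clm_ext_real fun v => by simp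
      map_smul' := fun c T => clm_ext_real fun v => by simp }

/-- The complex multilinear extension of a real multilinear map on `ℝᵏ`. -/
def cplxMulti {n : ℕ} (p : ContinuousMultilinearMap ℝ (fun _ : Fin n => RModel k) E) :
    ContinuousMultilinearMap ℂ (fun _ : Fin n => CModel k) E :=
  ∑ f : Fin n → Fin k,
    ((ContinuousMultilinearMap.mkPiAlgebra ℂ (Fin n) ℂ).compContinuousLinearMap
      (fun i => (EuclideanSpace.proj (f i) : CModel k →L[ℂ] ℂ))).smulRight
        (p fun i => EuclideanSpace.single (f i) 1)

lemma cplxMulti_realIncl {n : ℕ} (p : ContinuousMultilinearMap ℝ (fun _ : Fin n => RModel k) E)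
    (v : Fin n → RModel k) : cplxMulti p (fun i => realIncl k (v i)) = p v := by
  have h : v = fun i => ∑ j, v i j • EuclideanSpace.single j (1 : ℝ) :=
    funext fun i => RModel.eq_sum (v i)
  conv_rhs => rw [h, ContinuousMultilinearMap.map_sum]
  simp only [cplxMulti, _root_.sum_apply,
    ContinuousMultilinearMap.smulRight_apply,
    ContinuousMultilinearMap.compContinuousLinearMap_apply,
    ContinuousMultilinearMap.mkPiAlgebra_apply, ContinuousMultilinearMap.map_smul_univ]
  refine Finset.sum_congr rfl fun f _ => ?_
  have : (∏ i, (EuclideanSpace.proj (f i) : CModel k →L[ℂ] ℂ) (realIncl k (v i)))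
      = ((∏ i, v i (f i) : ℝ) : ℂ) := by
    simp
  rw [this]
  exact Complex.coe_smul _ _

/-- Each of the `k ^ n` terms of the defining sum is bounded by `‖p‖` times the product of the
norms. The loss is geometric in `n`, so a complexified power series keeps a positive radius of
convergence. -/
lemma norm_cplxMulti_le {n : ℕ} (p : ContinuousMultilinearMap ℝ (fun _ : Fin n => RModel k) E) :
    ‖cplxMulti p‖ ≤ (k : ℝ) ^ n * ‖p‖ := by
  refine ContinuousMultilinearMap.opNorm_le_bound (by positivity) fun z => ?_
  simp only [cplxMulti, _root_.sum_apply,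
    ContinuousMultilinearMap.smulRight_apply,
    ContinuousMultilinearMap.compContinuousLinearMap_apply,
    ContinuousMultilinearMap.mkPiAlgebra_apply]
  refine (norm_sum_le _ _).trans ?_
  have h : ∀ f ∈ (Finset.univ : Finset (Fin n → Fin k)),
      ‖(∏ i, (EuclideanSpace.proj (f i) : CModel k →L[ℂ] ℂ) (z i)) •
        p fun i => EuclideanSpace.single (f i) 1‖ ≤ (∏ i, ‖z i‖) * ‖p‖ := by
    intro f _
    rw [norm_smul, norm_prod]
    refine mul_le_mul (Finset.prod_le_prod (fun _ _ => norm_nonneg _) fun i _ => ?_) ?_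
      (norm_nonneg _) (Finset.prod_nonneg fun _ _ => norm_nonneg _)
    · exact PiLp.norm_apply_le (z i) (f i)
    · refine (p.le_opNorm _).trans ?_
      simp
  refine (Finset.sum_le_card_nsmul _ _ _ h).trans ?_
  simp only [Finset.card_univ, Fintype.card_fun, Fintype.card_fin, nsmul_eq_mul, Nat.cast_pow]
  exact le_of_eq (by ring)

/-- A real analytic map on an open subset of `ℝᵏ` extends holomorphically to `ℂᵏ`, locally. -/
theorem exists_holomorphic_extension [CompleteSpace E] {h : RModel k → E} {a : RModel k}
    (hh : ContDiffAt ℝ ω h a) :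
    ∃ H : CModel k → E, ContDiffAt ℂ ω H (realIncl k a) ∧ ∀ᶠ x in 𝓝 a, H (realIncl k x) = h x := by
  obtain ⟨p, r, hp⟩ := hh.analyticAt
  let q : FormalMultilinearSeries ℂ (CModel k) E := fun n => cplxMulti (p n)
  have hq : 0 < q.radius := by
    obtain ⟨ρ, hρ0, hρ⟩ := ENNReal.lt_iff_exists_nnreal_btwn.1 hp.radius_pos
    obtain ⟨C, hC, hCb⟩ := p.norm_mul_pow_le_of_lt_radius hρ
    have hρ0' : (0 : NNReal) < ρ := by exact_mod_cast hρ0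
    -- Dividing the radius by `k + 1` absorbs the factor `k ^ n`; the `+ 1` covers `k = 0`.
    have : (((ρ / (k + 1) : NNReal)) : ENNReal) ≤ q.radius := by
      refine q.le_radius_of_bound C fun n => ?_
      refine le_trans ?_ (hCb n)
      have h1 := norm_cplxMulti_le (p n)
      have h2 : ((k : ℝ) / (k + 1)) ^ n ≤ 1 := by
        apply pow_le_one₀ (by positivity)
        rw [div_le_one (by positivity)]
        linarith
      calc ‖q n‖ * ((ρ / (k + 1) : NNReal) : ℝ) ^ n
          ≤ ((k : ℝ) ^ n * ‖p n‖) * ((ρ / (k + 1) : NNReal) : ℝ) ^ n := by gcongr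
        _ = ((k : ℝ) / (k + 1)) ^ n * (‖p n‖ * (ρ : ℝ) ^ n) := by
            push_cast
            rw [div_pow, div_pow]
            ring
        _ ≤ 1 * (‖p n‖ * (ρ : ℝ) ^ n) := by gcongr
        _ = _ := one_mul _
    refine lt_of_lt_of_le ?_ this
    rw [ENNReal.coe_pos]
    positivity
  refine ⟨fun z => q.sum (z - realIncl k a), ?_, ?_⟩
  · have h0 : AnalyticAt ℂ q.sum (realIncl k a - realIncl k a) := by
      rw [sub_self]
      exact (q.hasFPowerSeriesOnBall hq).analyticAt
    exact h0.contDiffAt.comp (realIncl k a) (f := fun z => z - realIncl k a)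
      (contDiffAt_id.sub contDiffAt_const)
  · filter_upwards [Metric.eball_mem_nhds a hp.r_pos] with x hx
    have hx' : x - a ∈ Metric.eball (0 : RModel k) r := by
      rw [Metric.mem_eball, edist_zero_right, ← edist_eq_enorm_sub]
      exact hx
    have hs := (hp.hasSum hx').tsum_eq
    rw [add_sub_cancel] at hs
    rw [← hs, FormalMultilinearSeries.sum, ← map_sub]
    exact tsum_congr fun n => cplxMulti_realIncl (p n) _

/-- A holomorphic map on `ℂᵏ` which vanishes at the real points near a real point vanishes
near this point. -/
theorem eventually_eq_zero_of_real {H : CModel k → E} [CompleteSpace E] {a : RModel k}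
    (hH : ContDiffAt ℂ ω H (realIncl k a)) (h0 : ∀ᶠ x in 𝓝 a, H (realIncl k x) = 0) :
    ∀ᶠ z in 𝓝 (realIncl k a), H z = 0 := by
  have hA : ∀ᶠ z in 𝓝 (realIncl k a), AnalyticAt ℂ H z := hH.analyticAt.eventually_analyticAt
  obtain ⟨ε, hε, hεA⟩ := Metric.eventually_nhds_iff.1 hA
  obtain ⟨δ, hδ, hδ0⟩ := Metric.eventually_nhds_iff.1 h0
  -- `w` is the imaginary part of `z`, and the point moves along `t ↦ Re z + t w`
  let w : CModel k → RModel k := fun z => rePart k (-Complex.I • z)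
  have hw : Continuous w := by fun_prop
  have hw0 : w (realIncl k a) = 0 := by ext i; simp [w]
  have hr0 : rePart k (realIncl k a) = a := by ext i; simp
  -- The constants `ε / 2` and `ε / 4` keep the line `γ` below inside the `ε`-ball for `‖t‖ < 2`, a
  -- disc that contains both `0` and `Complex.I`.
  have e1 : ∀ᶠ z in 𝓝 (realIncl k a), ‖realIncl k (rePart k z) - realIncl k a‖ < ε / 2 := by
    have : ContinuousAt (fun z => ‖realIncl k (rePart k z) - realIncl k a‖) (realIncl k a) := by
      fun_prop
    refine this.eventually_lt_const ?_
    simp [hr0, hε]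
  have e2 : ∀ᶠ z in 𝓝 (realIncl k a), ‖realIncl k (w z)‖ < ε / 4 := by
    have : ContinuousAt (fun z => ‖realIncl k (w z)‖) (realIncl k a) := by fun_prop
    refine this.eventually_lt_const ?_
    simp [hw0, hε]
  have e3 : ∀ᶠ z in 𝓝 (realIncl k a), ‖rePart k z - a‖ < δ := by
    have : ContinuousAt (fun z => ‖rePart k z - a‖) (realIncl k a) := by fun_prop
    refine this.eventually_lt_const ?_
    simp [hr0, hδ]
  filter_upwards [e1, e2, e3] with z h1 h2 h3
  let γ : ℂ → CModel k := fun t => realIncl k (rePart k z) + t • realIncl k (w z)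
  have hγ : AnalyticOnNhd ℂ (fun t => H (γ t)) (Metric.ball 0 2) := by
    intro t ht
    have h4 : AnalyticAt ℂ H (γ t) := by
      apply hεA
      rw [dist_eq_norm]
      have ht' : ‖t‖ < 2 := by simpa using ht
      calc ‖γ t - realIncl k a‖
          = ‖(realIncl k (rePart k z) - realIncl k a) + t • realIncl k (w z)‖ := by
            congr 1; simp only [γ]; abel
        _ ≤ ‖realIncl k (rePart k z) - realIncl k a‖ + ‖t‖ * ‖realIncl k (w z)‖ := by
            rw [← norm_smul]; exact norm_add_le _ _
        _ < ε := by nlinarith [norm_nonneg t, norm_nonneg (realIncl k (w z))]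
    exact h4.comp (f := γ) (by fun_prop)
  -- For small real `t` the point `γ t` is real and close to `a`, so the zeros of `H ∘ γ` accumulate
  -- at `0`. The one-variable identity theorem then reaches `t = i`, where `γ` takes the value `z`.
  have hfr : ∃ᶠ t in 𝓝[≠] (0 : ℂ), H (γ t) = 0 := by
    have hreal : ∀ᶠ t : ℝ in 𝓝 0, H (γ (t : ℂ)) = 0 := by
      have : ContinuousAt (fun t : ℝ => ‖rePart k z + t • w z - a‖) 0 := by fun_prop
      filter_upwards [this.eventually_lt_const (u := δ) (by simpa using h3)] with t ht
      have : γ (t : ℂ) = realIncl k (rePart k z + t • w z) := by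
        simp only [γ, map_add, map_smul]
        congr 1
      rw [this]
      apply hδ0
      rwa [dist_eq_norm]
    have hreal' : ∃ᶠ t : ℝ in 𝓝[≠] 0, H (γ (t : ℂ)) = 0 :=
      (hreal.filter_mono nhdsWithin_le_nhds).frequently
    have ht : Tendsto (fun t : ℝ => (t : ℂ)) (𝓝[≠] 0) (𝓝[≠] 0) := by
      refine tendsto_nhdsWithin_iff.2 ⟨?_, ?_⟩
      · exact (Complex.continuous_ofReal.tendsto' 0 0 (by simp)).mono_left nhdsWithin_le_nhds
      · filter_upwards [self_mem_nhdsWithin] with t ht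
        simpa using ht
    exact ht.frequently hreal'
  have := hγ.eqOn_zero_of_preconnected_of_frequently_eq_zero
    (convex_ball (0 : ℂ) 2).isPreconnected (Metric.mem_ball_self (by norm_num)) hfr
    (show Complex.I ∈ Metric.ball (0 : ℂ) 2 by simp)
  have hz : γ Complex.I = z := realIncl_re_add_im z
  simpa [hz] using this

end Flat

/-! ### Totally real and generic subspaces -/

section LinearAlgebra

variable {k : ℕ} {V : Type*} [NormedAddCommGroup V] [NormedSpace ℂ V]

lemma mem_I_smul {W : Submodule ℝ V} {x : V} :
    x ∈ Complex.I • W ↔ ∃ y ∈ W, Complex.I • y = x :=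
  Submodule.mem_smul_pointwise_iff_exists x Complex.I W

/-- A relation `T u + i T v = 0` places `T u` in the intersection of the range with its multiple by
`i`. Hence `T u` and `T v` vanish, and so do `u` and `v`. -/
lemma cplx_injective {T : RModel k →L[ℝ] V} (hT : Function.Injective T)
    (hW : IsTotallyReal T.range) : Function.Injective (cplx T) := by
  rw [injective_iff_map_eq_zero]
  intro z hz
  rw [cplx_apply] at hz
  have hmem : T (rePart k z) ∈ T.range ⊓ Complex.I • T.range := by
    refine ⟨⟨_, rfl⟩, mem_I_smul.2 ⟨T (-rePart k (-Complex.I • z)), ⟨_, rfl⟩, ?_⟩⟩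
    rw [map_neg, smul_neg]
    exact (eq_neg_of_add_eq_zero_left hz).symm
  rw [show T.range ⊓ Complex.I • T.range = ⊥ from hW, Submodule.mem_bot] at hmem
  rw [hmem, zero_add, smul_eq_zero_iff_right Complex.I_ne_zero] at hz
  rw [← realIncl_re_add_im z, hT (hmem.trans (map_zero T).symm), hT (hz.trans (map_zero T).symm)]
  simp

lemma isTotallyReal_of_cplx_injective {T : RModel k →L[ℝ] V}
    (h : Function.Injective (cplx T)) : IsTotallyReal T.range := by
  rw [IsTotallyReal, eq_bot_iff]
  rintro x ⟨⟨u, hu⟩, hx⟩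
  obtain ⟨-, ⟨v, rfl⟩, hv⟩ := mem_I_smul.1 hx
  have h0 : cplx T (realIncl k u) = cplx T (Complex.I • realIncl k v) := by
    rw [map_smul, cplx_realIncl, cplx_realIncl]
    exact hu.trans hv.symm
  have h1 := h h0
  have hu0 : u = 0 := by
    ext i
    have := congrArg (fun z : CModel k => (z i).re) h1
    simpa using this
  rw [Submodule.mem_bot, ← hu, hu0]
  exact map_zero T

lemma injective_of_cplx_injective {T : RModel k →L[ℝ] V}
    (h : Function.Injective (cplx T)) : Function.Injective T := by
  intro u v huv
  apply realIncl_injective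
  apply h
  simpa using huv

lemma cplx_surjective {T : RModel k →L[ℝ] V} (hW : IsGeneric T.range) :
    Function.Surjective (cplx T) := by
  intro x
  have hx : x ∈ T.range ⊔ Complex.I • T.range := by
    rw [show T.range ⊔ Complex.I • T.range = ⊤ from hW]; trivial
  obtain ⟨-, ⟨u, rfl⟩, y, hy, rfl⟩ := Submodule.mem_sup.1 hx
  obtain ⟨-, ⟨v, rfl⟩, rfl⟩ := mem_I_smul.1 hy
  refine ⟨realIncl k u + Complex.I • realIncl k v, ?_⟩
  rw [map_add, map_smul, cplx_realIncl, cplx_realIncl]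
  rfl

lemma isGeneric_of_cplx_surjective {T : RModel k →L[ℝ] V}
    (h : Function.Surjective (cplx T)) : IsGeneric T.range := by
  rw [IsGeneric, eq_top_iff]
  intro x _
  obtain ⟨z, rfl⟩ := h x
  rw [cplx_apply]
  exact Submodule.add_mem_sup ⟨_, rfl⟩ (mem_I_smul.2 ⟨_, ⟨_, rfl⟩, rfl⟩)

lemma IsTotallyReal.mono {W W' : Submodule ℝ V} (h : IsTotallyReal W') (hW : W ≤ W') :
    IsTotallyReal W := by
  rw [IsTotallyReal, eq_bot_iff] at *
  rintro x ⟨hx, hx'⟩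
  obtain ⟨y, hy, rfl⟩ := mem_I_smul.1 hx'
  exact h ⟨hW hx, mem_I_smul.2 ⟨y, hW hy, rfl⟩⟩

/-- For `x = i y` with `x`, `y` in `W`, both `B y w` and `i B y w` are real for each `w` in `W`, so
they vanish, and non-degeneracy gives `x = 0`. -/
lemma IsRealSlice.isTotallyReal {B : V →L[ℂ] V →L[ℂ] ℂ} {W : Submodule ℝ V}
    (h : IsRealSlice B W) : IsTotallyReal W := by
  rw [IsTotallyReal, eq_bot_iff]
  rintro x ⟨hx, hx'⟩
  obtain ⟨y, hy, rfl⟩ := mem_I_smul.1 hx'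
  refine (Submodule.mem_bot _).2 (h.2 _ hx fun w hw => ?_)
  have h1 := h.1 _ hx w hw
  have h2 := h.1 y hy w hw
  rw [map_smul, _root_.smul_apply, smul_eq_mul] at h1 ⊢
  have h3 : (B y w).re = 0 := by simpa using h1
  rw [show B y w = 0 from Complex.ext h3 h2, mul_zero]

end LinearAlgebra

/-! ### The inverse function theorem and straightening of immersions -/

section Straighten

variable {𝕜 : Type*} [RCLike 𝕜] {E E' F : Type*}
  [NormedAddCommGroup E] [NormedSpace 𝕜 E] [NormedAddCommGroup E'] [NormedSpace 𝕜 E']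
  [NormedAddCommGroup F] [NormedSpace 𝕜 F]

/-- An analytic map with invertible derivative is a local analytic diffeomorphism. -/
theorem exists_openPartialHomeomorph_contDiffOn [CompleteSpace E] {f : E → E'} {a : E}
    {f' : E ≃L[𝕜] E'} (hf : ContDiffAt 𝕜 ω f a) (hf' : HasFDerivAt f (f' : E →L[𝕜] E') a) :
    ∃ R : OpenPartialHomeomorph E E', a ∈ R.source ∧ (R : E → E') = f ∧
      ContDiffOn 𝕜 ω R R.source ∧ ContDiffOn 𝕜 ω R.symm R.target := by
  have hω : (ω : WithTop ℕ∞) ≠ 0 := by simp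
  let R₀ := hf.toOpenPartialHomeomorph f hf' hω
  have ha : a ∈ R₀.source := hf.mem_toOpenPartialHomeomorph_source hf' hω
  have hfa : f a ∈ R₀.target := hf.image_mem_toOpenPartialHomeomorph_target hf' hω
  -- The inverse is known to be analytic at `f a` only. Analyticity at a point persists nearby, so
  -- the source is cut down to an open set on which both maps are analytic.
  have h1 : ∀ᶠ x in 𝓝 a, ContDiffAt 𝕜 ω f x := hf.eventually (by simp)
  have h2 : ∀ᶠ y in 𝓝 (f a), ContDiffAt 𝕜 ω R₀.symm y :=
    (hf.to_localInverse hf' hω : ContDiffAt 𝕜 ω R₀.symm (f a)).eventually (by simp)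
  have h3 : ∀ᶠ x in 𝓝 a, ContDiffAt 𝕜 ω R₀.symm (f x) := hf.continuousAt.eventually h2
  obtain ⟨U, hU, hUo, haU⟩ := eventually_nhds_iff.1 (h1.and h3)
  refine ⟨R₀.restrOpen U hUo, ⟨ha, haU⟩, rfl, fun x hx => ?_, fun y hy => ?_⟩
  · exact (hU x hx.2).1.contDiffWithinAt
  · have hy1 : y ∈ R₀.target := hy.1
    have hy2 : R₀.symm y ∈ U := hy.2
    have := (hU _ hy2).2
    rw [show f (R₀.symm y) = y from R₀.right_inv hy1] at this
    exact this.contDiffWithinAt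

/-- An analytic map with injective derivative is the inclusion of a linear subspace after a local
analytic change of coordinates of the target. -/
theorem exists_straightening [FiniteDimensional 𝕜 E] [FiniteDimensional 𝕜 E']
    [FiniteDimensional 𝕜 F] (hdim : Module.finrank 𝕜 E + Module.finrank 𝕜 F = Module.finrank 𝕜 E')
    {h : E → E'} {a : E} (hh : ContDiffAt 𝕜 ω h a) {L : E →L[𝕜] E'} (hL : HasFDerivAt h L a)
    (hinj : Function.Injective L) :
    ∃ (Ψ : OpenPartialHomeomorph E' E') (e : (E × F) ≃L[𝕜] E'), h a ∈ Ψ.source ∧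
      ContDiffOn 𝕜 ω Ψ Ψ.source ∧ ContDiffOn 𝕜 ω Ψ.symm Ψ.target ∧
      ∀ᶠ u in 𝓝 a, Ψ (h u) = e (u, 0) := by
  have : CompleteSpace E' := FiniteDimensional.complete 𝕜 E'
  obtain ⟨C, hC⟩ := Submodule.exists_isCompl (L : E →ₗ[𝕜] E').range
  have hfin : Module.finrank 𝕜 F = Module.finrank 𝕜 C := by
    have h1 := Submodule.finrank_add_eq_of_isCompl hC
    rw [LinearMap.finrank_range_of_inj hinj] at h1
    omega
  let κ : F ≃ₗ[𝕜] C := LinearEquiv.ofFinrankEq F C hfin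
  let e₀ : (E × F) ≃ₗ[𝕜] E' :=
    ((LinearEquiv.ofInjective (L : E →ₗ[𝕜] E') hinj).prodCongr κ).trans
      (Submodule.prodEquivOfIsCompl _ _ hC)
  let e : (E × F) ≃L[𝕜] E' := e₀.toContinuousLinearEquiv
  let κ' : F →L[𝕜] E' := (C.subtype ∘ₗ κ.toLinearMap).toContinuousLinearMap
  have he : ∀ u c, e (u, c) = L u + κ' c := fun u c => by
    simp [e, e₀, κ']
  -- `Φ (e (u, c)) = h u + κ' c` thickens `h` along a complement of the range of `L`. As `e (u, c) =
  -- L u + κ' c`, its derivative at `e (a, 0)` is the identity, and its local inverse is the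
  -- required `Ψ`.
  let Φ : E' → E' := fun w => h (e.symm w).1 + κ' (e.symm w).2
  let l1 : E' →L[𝕜] E := (ContinuousLinearMap.fst 𝕜 E F).comp (e.symm : E' →L[𝕜] (E × F))
  let l2 : E' →L[𝕜] F := (ContinuousLinearMap.snd 𝕜 E F).comp (e.symm : E' →L[𝕜] (E × F))
  have ha : l1 (e (a, 0)) = a := by simp [l1]
  have hΦ : ContDiffAt 𝕜 ω Φ (e (a, 0)) := by
    refine ContDiffAt.add ?_ (κ'.comp l2).contDiff.contDiffAt
    exact ContDiffAt.comp (e (a, 0)) (g := h) (f := l1) (by rw [ha]; exact hh)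
      l1.contDiff.contDiffAt
  have hΦ' : HasFDerivAt Φ ((ContinuousLinearEquiv.refl 𝕜 E' : E' ≃L[𝕜] E') : E' →L[𝕜] E')
      (e (a, 0)) := by
    have h1 : HasFDerivAt Φ (L.comp l1 + κ'.comp l2) (e (a, 0)) := by
      refine HasFDerivAt.add ?_ (κ'.comp l2).hasFDerivAt
      exact HasFDerivAt.comp (e (a, 0)) (g := h) (f := l1) (by rw [ha]; exact hL)
        l1.hasFDerivAt
    convert h1 using 1
    ext1 w
    have := he (e.symm w).1 (e.symm w).2
    rw [Prod.mk.eta, e.apply_symm_apply] at this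
    simpa [l1, l2] using this
  obtain ⟨R, hR, hRΦ, hR1, hR2⟩ := exists_openPartialHomeomorph_contDiffOn hΦ hΦ'
  have hRu : ∀ u, R (e (u, 0)) = h u := fun u => by
    rw [hRΦ]
    simp [Φ]
  refine ⟨R.symm, e, ?_, hR2, by simpa using hR1, ?_⟩
  · have := R.map_source hR
    rw [hRu] at this
    simpa using this
  · have hc : ContinuousAt (fun u : E => e (u, (0 : F))) a := by fun_prop
    filter_upwards [hc.eventually (R.open_source.mem_nhds hR)] with u hu
    rw [← hRu u]
    exact R.left_inv hu

end Straighten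

/-! ### Immersions and injective differentials -/

section Immersion

variable {𝕜 : Type*} [RCLike 𝕜] {E E' E'' F : Type*}
  [NormedAddCommGroup E] [NormedSpace 𝕜 E] [NormedAddCommGroup E'] [NormedSpace 𝕜 E']
  [NormedAddCommGroup E''] [NormedSpace 𝕜 E''] [NormedAddCommGroup F] [NormedSpace 𝕜 F]
  {M N : Type*} [TopologicalSpace M] [ChartedSpace E M]
  [TopologicalSpace N] [ChartedSpace E' N]

lemma trans_mem_maximalAtlas [IsManifold 𝓘(𝕜, E) ω M] {ψ : OpenPartialHomeomorph M E}
    (hψ : ψ ∈ IsManifold.maximalAtlas 𝓘(𝕜, E) ω M) {Ψ : OpenPartialHomeomorph E E}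
    (h1 : ContDiffOn 𝕜 ω Ψ Ψ.source) (h2 : ContDiffOn 𝕜 ω Ψ.symm Ψ.target) :
    ψ ≫ₕ Ψ ∈ IsManifold.maximalAtlas 𝓘(𝕜, E) ω M := by
  rw [IsManifold.mem_maximalAtlas_iff_contMDiffOn] at hψ ⊢
  refine ⟨?_, ?_⟩
  · exact h1.contMDiffOn.comp (hψ.1.mono fun x hx => hx.1) fun x hx => hx.2
  · exact hψ.2.comp (h2.contMDiffOn.mono fun x hx => hx.1) fun x hx => hx.2

lemma restr_mem_maximalAtlas [IsManifold 𝓘(𝕜, E) ω M] {ψ : OpenPartialHomeomorph M E}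
    (hψ : ψ ∈ IsManifold.maximalAtlas 𝓘(𝕜, E) ω M) {U : Set M} (hU : IsOpen U) :
    ψ.restrOpen U hU ∈ IsManifold.maximalAtlas 𝓘(𝕜, E) ω M := by
  rw [IsManifold.mem_maximalAtlas_iff_contMDiffOn] at hψ ⊢
  exact ⟨hψ.1.mono fun x hx => hx.1, hψ.2.mono fun x hx => hx.1⟩

lemma hasFDerivAt_of_mdifferentiableAt {f : M → N} {x : M}
    (hf : MDifferentiableAt 𝓘(𝕜, E) 𝓘(𝕜, E') f x) :
    HasFDerivAt (chartAt E' (f x) ∘ f ∘ (chartAt E x).symm)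
      (mfderiv 𝓘(𝕜, E) 𝓘(𝕜, E') f x : E →L[𝕜] E') (chartAt E x x) := by
  have := hf.hasMFDerivAt.2
  simp only [writtenInExtChartAt, mfld_simps, Set.range_id] at this
  exact hasFDerivWithinAt_univ.1 this

lemma contDiffAt_of_contMDiffAt {f : M → N} {x : M}
    (hf : ContMDiffAt 𝓘(𝕜, E) 𝓘(𝕜, E') ω f x) :
    ContDiffAt 𝕜 ω (chartAt E' (f x) ∘ f ∘ (chartAt E x).symm) (chartAt E x x) := by
  have := (contMDiffAt_iff.1 hf).2
  simpa [contDiffWithinAt_univ, mfld_simps] using this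

/-- The straightening of `f` written in charts is absorbed into the chart of the target; the chart
of the source is only shrunk to where the normal form holds. -/
theorem isImmersionAtOfComplement_of_injective_mfderiv
    [FiniteDimensional 𝕜 E] [FiniteDimensional 𝕜 E'] [FiniteDimensional 𝕜 F]
    [IsManifold 𝓘(𝕜, E) ω M] [IsManifold 𝓘(𝕜, E') ω N]
    (hdim : Module.finrank 𝕜 E + Module.finrank 𝕜 F = Module.finrank 𝕜 E')
    {f : M → N} {x : M} (hf : ContMDiffAt 𝓘(𝕜, E) 𝓘(𝕜, E') ω f x)
    (hinj : Function.Injective (mfderiv 𝓘(𝕜, E) 𝓘(𝕜, E') f x)) :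
    Manifold.IsImmersionAtOfComplement F 𝓘(𝕜, E) 𝓘(𝕜, E') ω f x := by
  set φ := chartAt E x with hφ
  set ψ := chartAt E' (f x) with hψ
  obtain ⟨Ψ, e, hsrc, h1, h2, hev⟩ := exists_straightening (F := F) hdim
    (contDiffAt_of_contMDiffAt hf)
    (hasFDerivAt_of_mdifferentiableAt (hf.mdifferentiableAt (by simp))) hinj
  have hx : x ∈ φ.source := mem_chart_source E x
  have hfx : f x ∈ ψ.source := mem_chart_source E' (f x)
  have hxφ : φ.symm (φ x) = x := φ.left_inv hx
  have hev' : ∀ᶠ y in 𝓝 x, Ψ (ψ (f y)) = e (φ y, 0) := by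
    have := (φ.continuousAt hx).eventually hev
    filter_upwards [this, φ.open_source.mem_nhds hx] with y hy hyφ
    simpa [← hφ, ← hψ, φ.left_inv hyφ] using hy
  obtain ⟨U, hU, hUo, hxU⟩ := eventually_nhds_iff.1 hev'
  refine Manifold.IsImmersionAtOfComplement.mk_of_continuousAt hf.continuousAt e
    (φ.restrOpen U hUo) (ψ ≫ₕ Ψ) ⟨hx, hxU⟩ ⟨hfx, ?_⟩
    (restr_mem_maximalAtlas (IsManifold.chart_mem_maximalAtlas x) hUo)
    (trans_mem_maximalAtlas (IsManifold.chart_mem_maximalAtlas (f x)) h1 h2) ?_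
  · have : (ψ ∘ f ∘ φ.symm) (φ x) = ψ (f x) := by simp [hxφ]
    change ψ (f x) ∈ Ψ.source
    rw [← this]
    exact hsrc
  · intro u hu
    have hu' : u ∈ φ.target ∧ φ.symm u ∈ U := by
      simpa [mfld_simps] using hu
    have := hU _ hu'.2
    rw [φ.right_inv hu'.1] at this
    simpa [mfld_simps] using this

theorem isSmoothEmbedding_of_injective_mfderiv
    [FiniteDimensional 𝕜 E] [FiniteDimensional 𝕜 E']
    [IsManifold 𝓘(𝕜, E) ω M] [IsManifold 𝓘(𝕜, E') ω N]
    {f : M → N} (he : IsEmbedding f) (hf : ContMDiff 𝓘(𝕜, E) 𝓘(𝕜, E') ω f)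
    (hinj : ∀ x, Function.Injective (mfderiv 𝓘(𝕜, E) 𝓘(𝕜, E') f x)) :
    Manifold.IsSmoothEmbedding 𝓘(𝕜, E) 𝓘(𝕜, E') ω f := by
  refine ⟨?_, he⟩
  -- The subtraction is not truncated once there is a point `x`: injectivity of the differential at
  -- `x` bounds the dimension of `E` by that of `E'`.
  let F := EuclideanSpace 𝕜 (Fin (Module.finrank 𝕜 E' - Module.finrank 𝕜 E))
  refine Manifold.IsImmersionOfComplement.isImmersion (F := F) fun x => ?_
  refine isImmersionAtOfComplement_of_injective_mfderiv ?_ (hf x) (hinj x)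
  have hle : Module.finrank 𝕜 E ≤ Module.finrank 𝕜 E' :=
    LinearMap.finrank_le_finrank_of_injective
      (f := (show E →L[𝕜] E' from mfderiv 𝓘(𝕜, E) 𝓘(𝕜, E') f x).toLinearMap) (hinj x)
  simp only [F, finrank_euclideanSpace, Fintype.card_fin]
  omega

theorem injective_mfderiv_of_leftInverse {f : M → N} {g : N → M} {x : M}
    (hf : MDifferentiableAt 𝓘(𝕜, E) 𝓘(𝕜, E') f x)
    (hg : MDifferentiableAt 𝓘(𝕜, E') 𝓘(𝕜, E) g (f x)) (hgf : ∀ᶠ y in 𝓝 x, g (f y) = y) :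
    Function.Injective (mfderiv 𝓘(𝕜, E) 𝓘(𝕜, E') f x) := by
  have h1 : mfderiv 𝓘(𝕜, E) 𝓘(𝕜, E) (g ∘ f) x = ContinuousLinearMap.id 𝕜 _ := by
    rw [Filter.EventuallyEq.mfderiv_eq (show g ∘ f =ᶠ[𝓝 x] id from hgf), mfderiv_id]
  rw [mfderiv_comp x hg hf] at h1
  have h2 : ∀ v : E, mfderiv 𝓘(𝕜, E') 𝓘(𝕜, E) g (f x)
      ((mfderiv 𝓘(𝕜, E) 𝓘(𝕜, E') f x : E →L[𝕜] E') v) = v := fun v =>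
    congrArg (fun T : E →L[𝕜] E => T v) h1
  intro v w hvw
  rw [← h2 v, ← h2 w]
  exact congrArg _ hvw

/-- In immersion charts `f` is `u ↦ e (u, 0)`, so projecting to the first factor gives a local
analytic left inverse. -/
theorem injective_mfderiv_of_isImmersionAt [IsManifold 𝓘(𝕜, E) ω M] [IsManifold 𝓘(𝕜, E') ω N]
    {f : M → N} {x : M} (hf : Manifold.IsImmersionAt 𝓘(𝕜, E) 𝓘(𝕜, E') ω f x) :
    Function.Injective (mfderiv 𝓘(𝕜, E) 𝓘(𝕜, E') f x) := by
  have hω : (ω : WithTop ℕ∞) ≠ 0 := by simp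
  let e := hf.equiv
  let φ := hf.domChart
  let ψ := hf.codChart
  let l : E' → E := fun w => (e.symm w).1
  have hl : ContDiff 𝕜 ω l := by fun_prop
  have hxφ : x ∈ φ.source := hf.mem_domChart_source
  have hloc : ∀ y ∈ φ.source, l (ψ (f y)) = φ y := fun y hy => by
    have := hf.writtenInCharts (show φ y ∈ (φ.extend 𝓘(𝕜, E)).target by
      simpa [mfld_simps] using φ.map_source hy)
    have h3 : ψ (f y) = e (φ y, 0) := by
      have h4 : φ.symm (φ y) = y := φ.left_inv hy
      have h5 : ψ (f (φ.symm (φ y))) = e (φ y, 0) := by simpa [mfld_simps] using this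
      rwa [h4] at h5
    simp [l, h3]
  have hlx : l (ψ (f x)) = φ x := hloc x hxφ
  refine injective_mfderiv_of_leftInverse (g := φ.symm ∘ l ∘ ψ)
    (hf.contMDiffAt.mdifferentiableAt hω) ?_ ?_
  · have h1 : ContMDiffAt 𝓘(𝕜, E') 𝓘(𝕜, E') ω ψ (f x) :=
      contMDiffAt_of_mem_maximalAtlas hf.codChart_mem_maximalAtlas hf.mem_codChart_source
    have h2 : ContMDiffAt 𝓘(𝕜, E) 𝓘(𝕜, E) ω φ.symm (l (ψ (f x))) := by
      rw [hlx]
      exact contMDiffAt_symm_of_mem_maximalAtlas hf.domChart_mem_maximalAtlas (φ.map_source hxφ)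
    have h3 : ContMDiffAt 𝓘(𝕜, E') 𝓘(𝕜, E) ω l (ψ (f x)) := hl.contMDiff.contMDiffAt
    exact (ContMDiffAt.comp (f x) (g := φ.symm) (f := l ∘ ψ) h2
      (ContMDiffAt.comp (f x) (g := l) (f := ψ) h3 h1)).mdifferentiableAt hω
  · filter_upwards [φ.open_source.mem_nhds hxφ] with y hy
    simp [hloc y hy, φ.left_inv hy]

lemma injective_mfderiv_of_isSmoothEmbedding
    [IsManifold 𝓘(𝕜, E) ω M] [IsManifold 𝓘(𝕜, E') ω N]
    {f : M → N} (hf : Manifold.IsSmoothEmbedding 𝓘(𝕜, E) 𝓘(𝕜, E') ω f) (x : M) :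
    Function.Injective (mfderiv 𝓘(𝕜, E) 𝓘(𝕜, E') f x) :=
  injective_mfderiv_of_isImmersionAt (hf.isImmersion.isImmersionAt x)

/-- Injectivity of differentials is stable under composition by the chain rule, so no charts of the
two immersions need to be matched. -/
theorem isSmoothEmbedding_comp [FiniteDimensional 𝕜 E] [FiniteDimensional 𝕜 E'']
    {Y : Type*} [TopologicalSpace Y] [ChartedSpace E'' Y]
    [IsManifold 𝓘(𝕜, E) ω M] [IsManifold 𝓘(𝕜, E') ω N] [IsManifold 𝓘(𝕜, E'') ω Y]
    {g : N → Y} {f : M → N} (hg : Manifold.IsSmoothEmbedding 𝓘(𝕜, E') 𝓘(𝕜, E'') ω g)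
    (hf : Manifold.IsSmoothEmbedding 𝓘(𝕜, E) 𝓘(𝕜, E') ω f) :
    Manifold.IsSmoothEmbedding 𝓘(𝕜, E) 𝓘(𝕜, E'') ω (g ∘ f) := by
  have hω : (ω : WithTop ℕ∞) ≠ 0 := by simp
  refine isSmoothEmbedding_of_injective_mfderiv (hg.isEmbedding.comp hf.isEmbedding)
    (hg.contMDiff.comp hf.contMDiff) fun x => ?_
  rw [mfderiv_comp x (hg.contMDiff.mdifferentiableAt hω) (hf.contMDiff.mdifferentiableAt hω)]
  exact (injective_mfderiv_of_isSmoothEmbedding hg (f x)).comp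
    (injective_mfderiv_of_isSmoothEmbedding hf x)

end Immersion

/-! ### Complex manifolds as real manifolds -/

section RestrictScalars

variable {E E' : Type*} [NormedAddCommGroup E] [NormedSpace ℂ E]
  [NormedAddCommGroup E'] [NormedSpace ℂ E']
  {M N : Type*} [TopologicalSpace M] [ChartedSpace E M]
  [TopologicalSpace N] [ChartedSpace E' N]

variable (E M) in
theorem isManifold_real [IsManifold 𝓘(ℂ, E) ω M] : IsManifold 𝓘(ℝ, E) ω M := by
  refine isManifold_of_contDiffOn _ _ _ fun e e' he he' => ?_
  have h := (contDiffGroupoid ω 𝓘(ℂ, E)).compatible he he'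
  rw [contDiffGroupoid, mem_groupoid_of_pregroupoid] at h
  exact ContDiffOn.restrict_scalars ℝ h.1

theorem contMDiffAt_real {f : M → N} {x : M} (hf : ContMDiffAt 𝓘(ℂ, E) 𝓘(ℂ, E') ω f x) :
    ContMDiffAt 𝓘(ℝ, E) 𝓘(ℝ, E') ω f x := by
  rw [contMDiffAt_iff] at hf ⊢
  exact ⟨hf.1, hf.2.restrict_scalars ℝ⟩

theorem mfderiv_real {f : M → N} {x : M} (hf : MDifferentiableAt 𝓘(ℂ, E) 𝓘(ℂ, E') f x) :
    MDifferentiableAt 𝓘(ℝ, E) 𝓘(ℝ, E') f x ∧ ∀ v : E,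
    (mfderiv 𝓘(ℝ, E) 𝓘(ℝ, E') f x : E →L[ℝ] E') v = (mfderiv 𝓘(ℂ, E) 𝓘(ℂ, E') f x : E →L[ℂ] E') v
    := by
  have h1 := hf.hasMFDerivAt
  have h2 : HasMFDerivAt 𝓘(ℝ, E) 𝓘(ℝ, E') f x
      ((mfderiv 𝓘(ℂ, E) 𝓘(ℂ, E') f x : E →L[ℂ] E').restrictScalars ℝ) :=
    ⟨h1.1, HasFDerivWithinAt.restrictScalars ℝ h1.2⟩
  exact ⟨h2.mdifferentiableAt, fun v => congrArg (fun T : E →L[ℝ] E' => T v) h2.mfderiv⟩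

/-- The real and the complex differential of a holomorphic map are the same function, so injectivity
means the same over both fields. -/
theorem isImmersion_real [IsManifold 𝓘(ℂ, E) ω M] [IsManifold 𝓘(ℂ, E') ω N] {f : M → N}
    [FiniteDimensional ℂ E] [FiniteDimensional ℂ E']
    (hf : Manifold.IsSmoothEmbedding 𝓘(ℂ, E) 𝓘(ℂ, E') ω f) :
    Manifold.IsSmoothEmbedding 𝓘(ℝ, E) 𝓘(ℝ, E') ω f := by
  have := isManifold_real E M
  have := isManifold_real E' N
  have : FiniteDimensional ℝ E := FiniteDimensional.complexToReal E
  have : FiniteDimensional ℝ E' := FiniteDimensional.complexToReal E'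
  refine isSmoothEmbedding_of_injective_mfderiv hf.isEmbedding
    (fun x => contMDiffAt_real (hf.contMDiff x)) fun x v w hvw => ?_
  have h := (mfderiv_real (hf.contMDiff.mdifferentiableAt (by simp) (x := x))).2
  refine injective_mfderiv_of_isSmoothEmbedding hf x ?_
  exact (h v).symm.trans (hvw.trans (h w))

end RestrictScalars

/-! ### Charts adapted to a totally real map -/

section Adapted

variable {q r m : ℕ}
  {Q : Type*} [TopologicalSpace Q]
  {M : Type*} [TopologicalSpace M]
  {E : Type*} [NormedAddCommGroup E] [NormedSpace ℂ E]

/-- In the chart `φ` of `Q` and the chart `Θ` of `M`, the map `f` is, near `x`, the inclusion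
`ℝ^q → ℂ^q → ℂ^q × ℂ^r`. -/
def IsAdaptedAt (f : Q → M) (φ : OpenPartialHomeomorph Q (RModel q))
    (Θ : OpenPartialHomeomorph M (CModel m)) (e : (CModel q × CModel r) ≃L[ℂ] CModel m)
    (x : Q) : Prop :=
  x ∈ φ.source ∧ ∀ᶠ y in 𝓝 x, f y ∈ Θ.source ∧ Θ (f y) = e (realIncl q (φ y), 0)

/-- This permits two pairs of charts, centred at different points, to be compared at a common point
of `Q`. -/
lemma IsAdaptedAt.eventually {f : Q → M} {φ : OpenPartialHomeomorph Q (RModel q)}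
    {Θ : OpenPartialHomeomorph M (CModel m)} {e : (CModel q × CModel r) ≃L[ℂ] CModel m} {x : Q}
    (h : IsAdaptedAt f φ Θ e x) : ∀ᶠ y in 𝓝 x, IsAdaptedAt f φ Θ e y :=
  Filter.Eventually.and (φ.open_source.mem_nhds h.1) h.2.eventually_nhds

/-- The derivative of `H` is complex linear and agrees with `L` on real vectors, which determines
it. -/
lemma fderiv_eq_cplx {H : CModel q → E} {h : RModel q → E} {a : RModel q}
    {L : RModel q →L[ℝ] E} (hh : HasFDerivAt h L a) (hH : DifferentiableAt ℂ H (realIncl q a))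
    (hHh : ∀ᶠ x in 𝓝 a, H (realIncl q x) = h x) : HasFDerivAt H (cplx L) (realIncl q a) := by
  have h1 : HasFDerivAt (fun x => H (realIncl q x))
      (((fderiv ℂ H (realIncl q a)).restrictScalars ℝ).comp (realIncl q)) a :=
    (hH.hasFDerivAt.restrictScalars ℝ).comp a (realIncl q).hasFDerivAt
  have h2 := (h1.congr_of_eventuallyEq (hHh.mono fun x hx => hx.symm)).unique hh
  have h3 : cplx L = fderiv ℂ H (realIncl q a) := clm_ext_real fun v => by
    rw [cplx_realIncl, ← h2]
    rfl
  rw [h3]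
  exact hH.hasFDerivAt

variable [ChartedSpace (CModel m) M]

/-- A real analytic map whose differential is totally real is the inclusion of a real form of a
slice in suitable charts. -/
theorem exists_isAdaptedAt [ChartedSpace (RModel q) Q] [IsManifold 𝓘(ℂ, CModel m) ω M] (hqr : q + r = m) {f : Q → M} {x : Q}
    (hf : ContMDiffAt (𝓡 q) 𝓘(ℝ, CModel m) ω f x)
    (hinj : Function.Injective (cplx (realDifferential q m f x))) :
    ∃ Θ ∈ IsManifold.maximalAtlas 𝓘(ℂ, CModel m) ω M,
      ∃ e : (CModel q × CModel r) ≃L[ℂ] CModel m,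
        IsAdaptedAt f (chartAt (RModel q) x) Θ e x := by
  set φ := chartAt (RModel q) x with hφ
  set ψ := chartAt (CModel m) (f x) with hψ
  have hx : x ∈ φ.source := mem_chart_source _ x
  have hfx : f x ∈ ψ.source := mem_chart_source _ (f x)
  have hh := contDiffAt_of_contMDiffAt hf
  rw [← hφ, ← hψ] at hh
  have hL : HasFDerivAt (ψ ∘ f ∘ φ.symm) (realDifferential q m f x) (φ x) :=
    hasFDerivAt_of_mdifferentiableAt (hf.mdifferentiableAt (by simp))
  -- In charts `f` is merely real-analytic. Its holomorphic extension `H` has derivative `cplx` of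
  -- the differential of `f`, which is injective, so a holomorphic change of coordinates straightens
  -- `H` and `f` with it.
  obtain ⟨H, hH, hHh⟩ := exists_holomorphic_extension hh
  have hHL := fderiv_eq_cplx hL (hH.differentiableAt (by simp)) hHh
  obtain ⟨Ψ, e, hsrc, h1, h2, hev⟩ := exists_straightening (F := CModel r)
    (by simpa using hqr) hH hHL hinj
  have hHx : H (realIncl q (φ x)) = ψ (f x) := by
    rw [hHh.self_of_nhds]
    simp [φ.left_inv hx]
  have hmem : f x ∈ (ψ ≫ₕ Ψ).source := ⟨hfx, by
    rw [hHx] at hsrc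
    exact hsrc⟩
  refine ⟨ψ ≫ₕ Ψ, trans_mem_maximalAtlas (IsManifold.chart_mem_maximalAtlas (f x)) h1 h2, e, hx, ?_⟩
  have hφx := φ.continuousAt hx
  have hι : ContinuousAt (fun y => realIncl q (φ y)) x :=
    ((realIncl q).continuous.continuousAt).comp hφx
  filter_upwards [hι.eventually hev, hφx.eventually hHh, φ.open_source.mem_nhds hx,
    hf.continuousAt.eventually ((ψ ≫ₕ Ψ).open_source.mem_nhds hmem)] with y h3 h4 h5 h6
  refine ⟨h6, ?_⟩
  rw [h4] at h3
  simpa [φ.left_inv h5] using h3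

variable {f : Q → M} {φ : OpenPartialHomeomorph Q (RModel q)}
  {Θ : OpenPartialHomeomorph M (CModel m)} {e : (CModel q × CModel r) ≃L[ℂ] CModel m} {x : Q}

/-- A holomorphic map which vanishes on a totally real submanifold vanishes on the complex slice
containing it. -/
theorem eventually_eq_zero_on_slice [CompleteSpace E] [IsManifold 𝓘(ℂ, CModel m) ω M]
    (hΘ : Θ ∈ IsManifold.maximalAtlas 𝓘(ℂ, CModel m) ω M) (had : IsAdaptedAt f φ Θ e x)
    {h : M → E} (hh : ContMDiffAt 𝓘(ℂ, CModel m) 𝓘(ℂ, E) ω h (f x))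
    (h0 : ∀ᶠ y in 𝓝 x, h (f y) = 0) :
    ∀ᶠ z in 𝓝 (f x), z ∈ Θ.source → (e.symm (Θ z)).2 = 0 → h z = 0 := by
  obtain ⟨hfx, hΘx⟩ := had.2.self_of_nhds
  let l : CModel q → CModel m := fun u => e (u, 0)
  have hl : ContMDiff 𝓘(ℂ, CModel q) 𝓘(ℂ, CModel m) ω l :=
    (show ContDiff ℂ ω l by fun_prop).contMDiff
  have hx : Θ.symm (l (realIncl q (φ x))) = f x := by
    simp only [l]
    rw [← hΘx, Θ.left_inv hfx]
  -- Parametrized by `ℂ^q`, the restriction of `h` to the slice is a holomorphic map that vanishes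
  -- at the real points near `φ x`, so the flat identity theorem applies.
  have hK : ContDiffAt ℂ ω (fun u => h (Θ.symm (l u))) (realIncl q (φ x)) := by
    rw [← contMDiffAt_iff_contDiffAt]
    refine ContMDiffAt.comp (realIncl q (φ x)) (g := h) (f := fun u => Θ.symm (l u))
      (by rw [hx]; exact hh) ?_
    refine ContMDiffAt.comp (realIncl q (φ x)) (g := Θ.symm) (f := l) ?_ hl.contMDiffAt
    refine contMDiffAt_symm_of_mem_maximalAtlas hΘ ?_
    simp only [l]
    rw [← hΘx]
    exact Θ.map_source hfx
  have hK0 : ∀ᶠ u in 𝓝 (φ x), h (Θ.symm (l (realIncl q u))) = 0 := by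
    have hc : Tendsto φ.symm (𝓝 (φ x)) (𝓝 x) := φ.tendsto_symm had.1
    filter_upwards [hc.eventually (h0.and had.2), φ.open_target.mem_nhds (φ.map_source had.1)]
      with u hu hu'
    obtain ⟨h1, h2, h3⟩ := hu
    rw [φ.right_inv hu'] at h3
    simp only [l]
    rw [← h3, Θ.left_inv h2, h1]
  have hfin := eventually_eq_zero_of_real hK hK0
  have hc : ContinuousAt (fun z => (e.symm (Θ z)).1) (f x) :=
    (continuous_fst.comp e.symm.continuous).continuousAt.comp (Θ.continuousAt hfx)
  have hcx : (e.symm (Θ (f x))).1 = realIncl q (φ x) := by rw [hΘx]; simp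
  have hc' : Tendsto (fun z => (e.symm (Θ z)).1) (𝓝 (f x)) (𝓝 (realIncl q (φ x))) := by
    rw [← hcx]; exact hc
  filter_upwards [hc'.eventually hfin] with z hz hzs hz2
  have : l (e.symm (Θ z)).1 = Θ z := by
    simp only [l]
    rw [← hz2, Prod.mk.eta, e.apply_symm_apply]
  rwa [this, Θ.left_inv hzs] at hz

/-- The function is extended from `ℝ^q` to `ℂ^q` in coordinates and taken constant in the `ℂ^r`
directions. -/
theorem exists_holomorphic_extension_of_isAdaptedAt [ChartedSpace (RModel q) Q] [CompleteSpace E]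
    [IsManifold 𝓘(ℂ, CModel m) ω M] [IsManifold (𝓡 q) ω Q]
    (hΘ : Θ ∈ IsManifold.maximalAtlas 𝓘(ℂ, CModel m) ω M)
    (hφ : φ ∈ IsManifold.maximalAtlas (𝓡 q) ω Q) (had : IsAdaptedAt f φ Θ e x)
    {h : Q → E} (hh : ContMDiffAt (𝓡 q) 𝓘(ℝ, E) ω h x) :
    ∃ H : M → E, ContMDiffAt 𝓘(ℂ, CModel m) 𝓘(ℂ, E) ω H (f x) ∧
      ∀ᶠ y in 𝓝 x, H (f y) = h y := by
  obtain ⟨hfx, hΘx⟩ := had.2.self_of_nhds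
  have hk : ContDiffAt ℝ ω (h ∘ φ.symm) (φ x) := by
    rw [← contMDiffAt_iff_contDiffAt]
    refine ContMDiffAt.comp (φ x) (g := h) (f := φ.symm) ?_
      (contMDiffAt_symm_of_mem_maximalAtlas hφ (φ.map_source had.1))
    rw [φ.left_inv had.1]
    exact hh
  obtain ⟨K, hK, hKh⟩ := exists_holomorphic_extension hk
  let l : CModel m → CModel q := fun w => (e.symm w).1
  have hl : ContDiff ℂ ω l := by fun_prop
  have hlx : l (Θ (f x)) = realIncl q (φ x) := by simp [l, hΘx]
  refine ⟨fun z => K (l (Θ z)), ?_, ?_⟩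
  · refine ContMDiffAt.comp (f x) (g := K) (f := fun z => l (Θ z)) (I' := 𝓘(ℂ, CModel q)) ?_ ?_
    · rw [hlx]; exact hK.contMDiffAt
    · exact ContMDiffAt.comp (f x) (g := l) (f := Θ) (I' := 𝓘(ℂ, CModel m))
        hl.contMDiff.contMDiffAt
        (contMDiffAt_of_mem_maximalAtlas hΘ hfx)
  · filter_upwards [had.2, (φ.continuousAt had.1).eventually hKh, φ.open_source.mem_nhds had.1]
      with y h1 h2 h3
    have h4 : l (Θ (f y)) = realIncl q (φ y) := by simp [l, h1.2]
    rw [h4, h2, Function.comp_apply, φ.left_inv h3]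

end Adapted

/-! ### Maximal totally real maps -/

section Maximal

variable {s : ℕ} {S : Type*} [TopologicalSpace S] [ChartedSpace (RModel s) S]
  {X : Type*} [TopologicalSpace X] [ChartedSpace (CModel s) X] [IsManifold 𝓘(ℂ, CModel s) ω X]
  {E : Type*} [NormedAddCommGroup E] [NormedSpace ℂ E] [CompleteSpace E] {j : S → X} {x : S}

/-- The identity theorem for a maximal totally real submanifold. -/
theorem eventually_eq_zero_of_totallyReal
    (hj : ContMDiffAt (𝓡 s) 𝓘(ℝ, CModel s) ω j x)
    (hinj : Function.Injective (cplx (realDifferential s s j x)))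
    {h : X → E} (hh : ContMDiffAt 𝓘(ℂ, CModel s) 𝓘(ℂ, E) ω h (j x))
    (h0 : ∀ᶠ y in 𝓝 x, h (j y) = 0) : ∀ᶠ z in 𝓝 (j x), h z = 0 := by
  -- With `r = 0` the slice fills the whole chart domain.
  obtain ⟨Θ, hΘ, e, had⟩ := exists_isAdaptedAt (r := 0) (by omega) hj hinj
  filter_upwards [eventually_eq_zero_on_slice hΘ had hh h0,
    Θ.open_source.mem_nhds had.2.self_of_nhds.1] with z hz hzs
  exact hz hzs (Subsingleton.elim _ _)

/-- Real analytic maps on a maximal totally real submanifold extend holomorphically. -/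
theorem exists_holomorphic_extension_of_totallyReal [IsManifold (𝓡 s) ω S]
    (hj : ContMDiffAt (𝓡 s) 𝓘(ℝ, CModel s) ω j x)
    (hinj : Function.Injective (cplx (realDifferential s s j x)))
    {h : S → E} (hh : ContMDiffAt (𝓡 s) 𝓘(ℝ, E) ω h x) :
    ∃ H : X → E, ContMDiffAt 𝓘(ℂ, CModel s) 𝓘(ℂ, E) ω H (j x) ∧
      ∀ᶠ y in 𝓝 x, H (j y) = h y := by
  obtain ⟨Θ, hΘ, e, had⟩ := exists_isAdaptedAt (r := 0) (by omega) hj hinj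
  exact exists_holomorphic_extension_of_isAdaptedAt hΘ (IsManifold.chart_mem_maximalAtlas x) had hh

end Maximal

/-! ### Embedded complex submanifolds as subsets -/

section Sliced

variable {q r m : ℕ} {M : Type*} [TopologicalSpace M] [ChartedSpace (CModel m) M]

variable (q r m) in
/-- The subset `X` of `M` is, in suitable charts, locally equal to the slice `ℂ^q × 0` of
`ℂ^q × ℂ^r`. -/
def IsSliced (X : Set M) : Prop :=
  ∀ z ∈ X, ∃ Θ ∈ IsManifold.maximalAtlas 𝓘(ℂ, CModel m) ω M,
    ∃ e : (CModel q × CModel r) ≃L[ℂ] CModel m, z ∈ Θ.source ∧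
      ∀ y ∈ Θ.source, y ∈ X ↔ (e.symm (Θ y)).2 = 0

lemma IsSliced.of_eventually [IsManifold 𝓘(ℂ, CModel m) ω M] {X : Set M}
    (h : ∀ z ∈ X, ∃ Θ ∈ IsManifold.maximalAtlas 𝓘(ℂ, CModel m) ω M,
      ∃ e : (CModel q × CModel r) ≃L[ℂ] CModel m, z ∈ Θ.source ∧
        ∀ᶠ y in 𝓝 z, y ∈ X ↔ (e.symm (Θ y)).2 = 0) : IsSliced q r m X := by
  intro z hz
  obtain ⟨Θ, hΘ, e, hzs, hev⟩ := h z hz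
  obtain ⟨U, hU, hUo, hzU⟩ := eventually_nhds_iff.1 hev
  exact ⟨Θ.restrOpen U hUo, restr_mem_maximalAtlas hΘ hUo, e, ⟨hzs, hzU⟩,
    fun y hy => hU y hy.2⟩

variable (q r) in
/-- The chart `c` of the subset `X` is induced by the chart `Θ` of `M`. -/
structure IsInducedChart {X : Set M} (c : OpenPartialHomeomorph X (CModel q))
    (Θ : OpenPartialHomeomorph M (CModel m)) (e : (CModel q × CModel r) ≃L[ℂ] CModel m) :
    Prop where
  mem_maximalAtlas : Θ ∈ IsManifold.maximalAtlas 𝓘(ℂ, CModel m) ω M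
  mem_source : ∀ z ∈ c.source, (z : M) ∈ Θ.source
  apply_eq : ∀ z ∈ c.source, Θ z = e (c z, 0)

lemma IsInducedChart.coe_symm {X : Set M} {c : OpenPartialHomeomorph X (CModel q)}
    {Θ : OpenPartialHomeomorph M (CModel m)} {e : (CModel q × CModel r) ≃L[ℂ] CModel m}
    (h : IsInducedChart q r c Θ e) {u : CModel q} (hu : u ∈ c.target) :
    e (u, 0) ∈ Θ.target ∧ (c.symm u : M) = Θ.symm (e (u, 0)) := by
  have h1 := c.map_target hu
  have h2 := h.apply_eq _ h1
  rw [c.right_inv hu] at h2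
  rw [← h2]
  exact ⟨Θ.map_source (h.mem_source _ h1), (Θ.left_inv (h.mem_source _ h1)).symm⟩

lemma IsSliced.exists_isInducedChart {X : Set M} (hX : IsSliced q r m X) (z : X) :
    ∃ c : OpenPartialHomeomorph X (CModel q), z ∈ c.source ∧
      ∃ (Θ : OpenPartialHomeomorph M (CModel m)) (e : (CModel q × CModel r) ≃L[ℂ] CModel m),
        IsInducedChart q r c Θ e := by
  classical
  obtain ⟨Θ, hΘ, e, hzs, hy⟩ := hX z z.2
  have hsec : ∀ y ∈ Θ.source, y ∈ X → e ((e.symm (Θ y)).1, 0) = Θ y := fun y h1 h2 => by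
    rw [← (hy y h1).1 h2, Prod.mk.eta, e.apply_symm_apply]
  have hinv : ∀ u : CModel q, e (u, 0) ∈ Θ.target → Θ.symm (e (u, 0)) ∈ X := fun u hu => by
    rw [hy _ (Θ.map_target hu), Θ.right_inv hu, e.symm_apply_apply]
  -- The value `z` outside the target is a default that makes `inv` total; no later step depends on
  -- it.
  let inv : CModel q → X := fun u =>
    if hu : e (u, 0) ∈ Θ.target then ⟨Θ.symm (e (u, 0)), hinv u hu⟩ else z
  have hinv' : ∀ u, e (u, 0) ∈ Θ.target → (inv u : M) = Θ.symm (e (u, 0)) := fun u hu => by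
    simp [inv, hu]
  let c : OpenPartialHomeomorph X (CModel q) :=
    { toFun := fun y => (e.symm (Θ y)).1
      invFun := inv
      source := {y | (y : M) ∈ Θ.source}
      target := {u | e (u, 0) ∈ Θ.target}
      map_source' := fun y h => by
        rw [Set.mem_ofPred_eq, hsec y h y.2]
        exact Θ.map_source h
      map_target' := fun u hu => by
        rw [Set.mem_ofPred_eq, hinv' u hu]
        exact Θ.map_target hu
      left_inv' := fun y h => by
        apply Subtype.ext
        rw [hinv' _ (by rw [hsec y h y.2]; exact Θ.map_source h), hsec y h y.2]
        exact Θ.left_inv h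
      right_inv' := fun u hu => by
        rw [hinv' u hu, Θ.right_inv hu, e.symm_apply_apply]
      open_source := Θ.open_source.preimage continuous_subtype_val
      open_target := Θ.open_target.preimage (by fun_prop)
      continuousOn_toFun := by
        refine (continuous_fst.comp e.symm.continuous).comp_continuousOn ?_
        exact Θ.continuousOn.comp continuous_subtype_val.continuousOn fun y h => h
      continuousOn_invFun := by
        rw [Topology.IsInducing.subtypeVal.continuousOn_iff]
        have : ContinuousOn (fun u : CModel q => Θ.symm (e (u, 0))) {u | e (u, 0) ∈ Θ.target} :=
          Θ.continuousOn_symm.comp (by fun_prop) fun u hu => hu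
        exact this.congr fun u hu => hinv' u hu }
  exact ⟨c, hzs, Θ, e, hΘ, fun y h => h, fun y h => (hsec y h y.2).symm⟩

/-- The charts induced on a sliced subset by the charts of the ambient manifold. -/
abbrev IsSliced.chartedSpace {X : Set M} (hX : IsSliced q r m X) : ChartedSpace (CModel q) X where
  atlas := {c | ∃ (Θ : OpenPartialHomeomorph M (CModel m))
    (e : (CModel q × CModel r) ≃L[ℂ] CModel m), IsInducedChart q r c Θ e}
  chartAt z := (hX.exists_isInducedChart z).choose
  mem_chart_source z := (hX.exists_isInducedChart z).choose_spec.1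
  chart_mem_atlas z := (hX.exists_isInducedChart z).choose_spec.2

/-- A transition map of induced charts is an ambient transition map preceded by `u ↦ e (u, 0)` and
followed by a linear projection. -/
theorem IsSliced.isManifold [IsManifold 𝓘(ℂ, CModel m) ω M] {X : Set M} (hX : IsSliced q r m X) :
    letI := hX.chartedSpace
    IsManifold 𝓘(ℂ, CModel q) ω X := by
  let := hX.chartedSpace
  refine isManifold_of_contDiffOn _ _ _ ?_
  rintro c c' ⟨Θ, e, h⟩ ⟨Θ', e', h'⟩
  have hl : ContDiff ℂ ω (fun u : CModel q => e (u, 0)) := by fun_prop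
  have hl' : ContDiff ℂ ω (fun w : CModel m => (e'.symm w).1) := by fun_prop
  have hΘ : ContDiffOn ℂ ω (Θ.symm ≫ₕ Θ') (Θ.symm ≫ₕ Θ').source := by
    have := IsManifold.compatible_of_mem_maximalAtlas h.mem_maximalAtlas h'.mem_maximalAtlas
    rw [contDiffGroupoid, mem_groupoid_of_pregroupoid] at this
    simpa [contDiffPregroupoid] using this.1
  have key : ∀ u ∈ (c.symm ≫ₕ c').source,
      e (u, 0) ∈ (Θ.symm ≫ₕ Θ').source ∧ c' (c.symm u) = (e'.symm (Θ' (Θ.symm (e (u, 0))))).1 := by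
    intro u hu
    have hu1 : u ∈ c.target := hu.1
    have hu2 : c.symm u ∈ c'.source := hu.2
    obtain ⟨h1, h2⟩ := h.coe_symm hu1
    have h3 := h'.mem_source _ hu2
    have h4 := h'.apply_eq _ hu2
    rw [h2] at h3 h4
    refine ⟨⟨h1, h3⟩, ?_⟩
    rw [h4, e'.symm_apply_apply]
  have := hl'.comp_contDiffOn (hΘ.comp hl.contDiffOn fun u hu => (key u hu).1)
  have h5 : ContDiffOn ℂ ω (c.symm ≫ₕ c') (c.symm ≫ₕ c').source :=
    this.congr fun u hu => (key u hu).2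
  simpa using h5

/-- The inclusion is locally `Θ.symm (e (c ·, 0))`, and the projection to the slice in the chart `Θ`
is a holomorphic left inverse near each point. -/
theorem IsSliced.isSmoothEmbedding_val [IsManifold 𝓘(ℂ, CModel m) ω M] {X : Set M}
    (hX : IsSliced q r m X) :
    letI := hX.chartedSpace
    Manifold.IsSmoothEmbedding 𝓘(ℂ, CModel q) 𝓘(ℂ, CModel m) ω (Subtype.val : X → M) := by
  let := hX.chartedSpace
  have := hX.isManifold
  have hω : (ω : WithTop ℕ∞) ≠ 0 := by simp
  have hl {e : (CModel q × CModel r) ≃L[ℂ] CModel m} :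
      ContMDiff 𝓘(ℂ, CModel q) 𝓘(ℂ, CModel m) ω (fun u : CModel q => e (u, 0)) :=
    (show ContDiff ℂ ω (fun u : CModel q => e (u, 0)) by fun_prop).contMDiff
  have hl' {e : (CModel q × CModel r) ≃L[ℂ] CModel m} :
      ContMDiff 𝓘(ℂ, CModel m) 𝓘(ℂ, CModel q) ω (fun w : CModel m => (e.symm w).1) :=
    (show ContDiff ℂ ω (fun w : CModel m => (e.symm w).1) by fun_prop).contMDiff
  have hsmooth : ContMDiff 𝓘(ℂ, CModel q) 𝓘(ℂ, CModel m) ω (Subtype.val : X → M) := by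
    intro z
    obtain ⟨Θ, e, h⟩ := chart_mem_atlas (CModel q) z
    set c := chartAt (CModel q) z
    have hz : z ∈ c.source := mem_chart_source _ z
    have h1 : ContMDiffAt 𝓘(ℂ, CModel q) 𝓘(ℂ, CModel q) ω c z :=
      contMDiffAt_of_mem_maximalAtlas (IsManifold.chart_mem_maximalAtlas z) hz
    have h2 : ContMDiffAt 𝓘(ℂ, CModel m) 𝓘(ℂ, CModel m) ω Θ.symm (e (c z, 0)) :=
      contMDiffAt_symm_of_mem_maximalAtlas h.mem_maximalAtlas (h.coe_symm (c.map_source hz)).1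
    have h3 : ContMDiffAt 𝓘(ℂ, CModel q) 𝓘(ℂ, CModel m) ω
        (fun y => Θ.symm ((fun u : CModel q => e (u, 0)) (c y))) z :=
      ContMDiffAt.comp z (g := Θ.symm) (f := fun y => (fun u : CModel q => e (u, 0)) (c y)) h2
        (ContMDiffAt.comp z (g := fun u : CModel q => e (u, 0)) (f := c) hl.contMDiffAt h1)
    refine h3.congr_of_eventuallyEq ?_
    filter_upwards [c.open_source.mem_nhds hz] with y hy
    have := (h.coe_symm (c.map_source hy)).2
    rw [c.left_inv hy] at this
    exact this
  refine isSmoothEmbedding_of_injective_mfderiv IsEmbedding.subtypeVal hsmooth fun z => ?_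
  obtain ⟨Θ, e, h⟩ := chart_mem_atlas (CModel q) z
  set c := chartAt (CModel q) z
  have hz : z ∈ c.source := mem_chart_source _ z
  have hcz : (e.symm (Θ z)).1 = c z := by
    rw [h.apply_eq z hz, e.symm_apply_apply]
  refine injective_mfderiv_of_leftInverse
    (g := fun y => c.symm ((fun w : CModel m => (e.symm w).1) (Θ y)))
    (hsmooth.mdifferentiableAt hω) (ContMDiffAt.mdifferentiableAt ?_ hω) ?_
  · refine ContMDiffAt.comp (z : M) (g := c.symm) (I' := 𝓘(ℂ, CModel q))
      (f := fun y => (fun w : CModel m => (e.symm w).1) (Θ y)) ?_ ?_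
    · simp only [hcz]
      exact contMDiffAt_symm_of_mem_maximalAtlas (IsManifold.chart_mem_maximalAtlas z)
        (c.map_source hz)
    · exact ContMDiffAt.comp (z : M) (g := fun w : CModel m => (e.symm w).1) (f := Θ)
        (I' := 𝓘(ℂ, CModel m)) hl'.contMDiffAt
        (contMDiffAt_of_mem_maximalAtlas h.mem_maximalAtlas (h.mem_source z hz))
  · filter_upwards [c.open_source.mem_nhds hz] with y hy
    rw [h.apply_eq y hy, e.symm_apply_apply]
    exact c.left_inv hy

end Sliced

/-! ### Complexifications -/

section Complexification

variable {q m : ℕ}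
  {Q : Type*} [TopologicalSpace Q] [ChartedSpace (RModel q) Q]
  {M : Type*} [TopologicalSpace M] [ChartedSpace (CModel m) M]

variable (q m) in
/-- A real analytic embedding with totally real differential. -/
structure IsTotallyRealEmbedding (f : Q → M) : Prop where
  isEmbedding : IsEmbedding f
  contMDiff : ContMDiff (𝓡 q) 𝓘(ℝ, CModel m) ω f
  injective_cplx : ∀ x, Function.Injective (cplx (realDifferential q m f x))

lemma IsTotallyRealEmbedding.le (f : Q → M) (x : Q) (h : IsTotallyRealEmbedding q m f) :
    q ≤ m := by
  have := LinearMap.finrank_le_finrank_of_injective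
    (f := (cplx (realDifferential q m f x)).toLinearMap) (h.injective_cplx x)
  simpa using this

lemma isTotallyRealEmbedding_of_isSmoothEmbedding [IsManifold (𝓡 q) ω Q]
    [IsManifold 𝓘(ℂ, CModel m) ω M] {f : Q → M}
    (hf : Manifold.IsSmoothEmbedding (𝓡 q) 𝓘(ℝ, CModel m) ω f)
    (h : ∀ x, IsTotallyReal (tangentImage q m f x)) : IsTotallyRealEmbedding q m f where
  isEmbedding := hf.isEmbedding
  contMDiff := hf.contMDiff
  injective_cplx x := by
    have := isManifold_real (CModel m) M
    exact cplx_injective (injective_mfderiv_of_isSmoothEmbedding hf x) (h x)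

/-- A holomorphic map is compatible with the complexified differentials. -/
lemma cplx_realDifferential_comp {s : ℕ} {X : Type*} [TopologicalSpace X]
    [ChartedSpace (CModel s) X] {κ : X → M} {j : Q → X} {x : Q}
    (hκ : MDifferentiableAt 𝓘(ℂ, CModel s) 𝓘(ℂ, CModel m) κ (j x))
    (hj : MDifferentiableAt (𝓡 q) 𝓘(ℝ, CModel s) j x) :
    cplx (realDifferential q m (fun y => κ (j y)) x) =
      (show CModel s →L[ℂ] CModel m from mfderiv 𝓘(ℂ, CModel s) 𝓘(ℂ, CModel m) κ (j x)).comp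
        (cplx (realDifferential q s j x)) := by
  refine clm_ext_real fun v => ?_
  obtain ⟨h1, h2⟩ := mfderiv_real hκ
  have h3 := mfderiv_comp x h1 hj
  rw [cplx_realIncl, ContinuousLinearMap.comp_apply, cplx_realIncl]
  exact (congrArg (fun T : RModel q →L[ℝ] CModel m => T v) h3).trans (h2 _)

/-- A complex submanifold of the right dimension which contains a totally real submanifold is a
complexification. -/
theorem isComplexification_of_isSmoothEmbedding [IsManifold (𝓡 q) ω Q]
    [IsManifold 𝓘(ℂ, CModel m) ω M] {f : Q → M} (hf : IsTotallyRealEmbedding q m f)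
    {X : Type*} [TopologicalSpace X] [ChartedSpace (CModel q) X] [IsManifold 𝓘(ℂ, CModel q) ω X]
    {κ : X → M} (hκ : Manifold.IsSmoothEmbedding 𝓘(ℂ, CModel q) 𝓘(ℂ, CModel m) ω κ)
    {j : Q → X} (hj : ∀ x, κ (j x) = f x) : IsComplexification q m f j κ := by
  have := isManifold_real (CModel m) M
  have := isManifold_real (CModel q) X
  have hω : (ω : WithTop ℕ∞) ≠ 0 := by simp
  have hcomp : κ ∘ j = f := funext hj
  have hje : IsEmbedding j := by
    have h1 : IsEmbedding (κ ∘ j) := hcomp ▸ hf.isEmbedding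
    exact (hκ.isEmbedding.of_comp_iff).1 h1
  -- As `κ` is an immersion and `j` is continuous, `j` inherits analyticity from `κ ∘ j = f`.
  have hjs : ContMDiff (𝓡 q) 𝓘(ℝ, CModel q) ω j := by
    rw [ContMDiff.iff_comp_isImmersion (isImmersion_real hκ).isImmersion, hcomp]
    exact ⟨hje.continuous, hf.contMDiff⟩
  -- The complexified differential of `f` factors through that of `j`. Since `Q` and `X` have the
  -- same dimension `q`, injectivity gives surjectivity, that is, genericity.
  have hinj : ∀ x, Function.Injective (cplx (realDifferential q q j x)) := fun x => by
    have h1 := hf.injective_cplx x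
    rw [← funext hj, cplx_realDifferential_comp (hκ.contMDiff.mdifferentiableAt hω)
      (hjs.mdifferentiableAt hω)] at h1
    exact Function.Injective.of_comp h1
  refine ⟨hκ, isSmoothEmbedding_of_injective_mfderiv hje hjs fun x =>
    injective_of_cplx_injective (hinj x), hj, fun x => isTotallyReal_of_cplx_injective (hinj x),
    fun x => isGeneric_of_cplx_surjective ?_⟩
  exact LinearMap.injective_iff_surjective
    (f := (cplx (realDifferential q q j x)).toLinearMap) |>.1 (hinj x)

end Complexification

/-! ### Gluing germs along a subset -/

section Gluing

variable {M ι α : Type*} [TopologicalSpace M]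

/-- The cover is refined to a locally finite one and shrunk to closures. `O` is the set of points at
which all `D i` with the point in `closure (w i)` share one germ. By local finiteness there are
finitely many such `i` and no others occur nearby, so `O` is open. Near a point of `O`, any choice
`k` of an index then gives the same values. -/
lemma exists_glued_germ_of_cover [ParacompactSpace M] [T2Space M] (A : Set M) (U : ι → Set M)
    (hU : ∀ i, IsOpen (U i)) (hcov : ⋃ i, U i = Set.univ) (D : ι → M → α)
    (h : ∀ i j, ∀ z ∈ A, z ∈ U i → z ∈ U j → D i =ᶠ[𝓝 z] D j) :
    ∃ O : Set M, IsOpen O ∧ A ⊆ O ∧ ∃ D' : M → α, ∀ z ∈ O, ∃ i, z ∈ U i ∧ D' =ᶠ[𝓝 z] D i := by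
  obtain ⟨v, hvo, hvcov, hvf, hvU⟩ := precise_refinement U hU hcov
  obtain ⟨w, hwcov, hwo, hwv⟩ := exists_iUnion_eq_closure_subset hvo hvf.point_finite hvcov
  have hwf : LocallyFinite fun i => closure (w i) := hvf.subset hwv
  have hex : ∀ z, ∃ i, z ∈ w i := fun z => by
    have : z ∈ ⋃ i, w i := hwcov ▸ Set.mem_univ z
    exact Set.mem_iUnion.1 this
  choose k hk using hex
  let O : Set M := {z | ∀ i j, z ∈ closure (w i) → z ∈ closure (w j) → D i =ᶠ[𝓝 z] D j}
  have hOo : IsOpen O := by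
    rw [isOpen_iff_mem_nhds]
    intro z hz
    have hfin : {i | z ∈ closure (w i)}.Finite := hwf.point_finite z
    have h1 : ∀ᶠ y in 𝓝 z, ∀ i ∈ {i | z ∈ closure (w i)}, ∀ j ∈ {i | z ∈ closure (w i)},
        D i =ᶠ[𝓝 y] D j := by
      rw [hfin.eventually_all]
      intro i hi
      rw [hfin.eventually_all]
      intro j hj
      exact (hz i j hi hj).eventuallyEq_nhds
    filter_upwards [h1, hwf.eventually_subset (fun i => isClosed_closure) z] with y hy hy' i j hi hj
    exact hy i (hy' hi) j (hy' hj)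
  refine ⟨O, hOo, fun z hz i j hi hj => h i j z hz (hvU i (hwv i hi)) (hvU j (hwv j hj)),
    fun z => D (k z) z, fun z hz => ⟨k z, hvU _ (hwv _ (subset_closure (hk z))), ?_⟩⟩
  have hfin : {i | z ∈ closure (w i)}.Finite := hwf.point_finite z
  have h1 : ∀ᶠ y in 𝓝 z, ∀ i ∈ {i | z ∈ closure (w i)}, D i y = D (k z) y := by
    rw [hfin.eventually_all]
    intro i hi
    exact hz i (k z) hi (subset_closure (hk z))
  filter_upwards [h1, hwf.eventually_subset (fun i => isClosed_closure) z] with y hy hy'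
  exact hy _ (hy' (subset_closure (hk y)))

/-- Functions defined near the points of a subset `A`, whose germs agree at the points of `A`,
come from a single function near `A`. -/
theorem exists_glued_germ [TopologicalSpace.MetrizableSpace M] [Nonempty α] (A : Set M) (U : ι → Set M)
    (hU : ∀ i, IsOpen (U i)) (hA : A ⊆ ⋃ i, U i) (D : ι → M → α)
    (h : ∀ i j, ∀ z ∈ A, z ∈ U i → z ∈ U j → D i =ᶠ[𝓝 z] D j) :
    ∃ O : Set M, IsOpen O ∧ A ⊆ O ∧ ∃ D' : M → α, ∀ z ∈ O, ∃ i, z ∈ U i ∧ D' =ᶠ[𝓝 z] D i := by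
  classical
  let V : Set M := ⋃ i, U i
  -- The sets `U i` need not cover `M`, so the gluing takes place in their union, which is
  -- metrizable and therefore paracompact. The value assigned off `V` does not affect germs at
  -- points of the open set `V`.
  have hV : IsOpen V := isOpen_iUnion hU
  have : ParacompactSpace V := by
    let := TopologicalSpace.metrizableSpaceMetric V
    infer_instance
  have hemb : IsOpenEmbedding (Subtype.val : V → M) := hV.isOpenEmbedding_subtypeVal
  obtain ⟨O, hO, hAO, D', hD'⟩ := exists_glued_germ_of_cover (M := V) (Subtype.val ⁻¹' A)
    (fun i => Subtype.val ⁻¹' U i) (fun i => (hU i).preimage continuous_subtype_val)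
    (by ext z; simpa using Set.mem_iUnion.1 z.2) (fun i z => D i z)
    (fun i j z hz hi hj => by
      have := h i j z hz hi hj
      exact continuous_subtype_val.continuousAt.eventually this)
  refine ⟨Subtype.val '' O, hemb.isOpenMap _ hO, fun z hz => ⟨⟨z, hA hz⟩, hAO hz, rfl⟩,
    fun z => if hz : z ∈ V then D' ⟨z, hz⟩ else Classical.arbitrary α, ?_⟩
  rintro _ ⟨z, hz, rfl⟩
  obtain ⟨i, hi, hiD⟩ := hD' z hz
  refine ⟨i, hi, ?_⟩
  rw [Filter.EventuallyEq, ← hemb.map_nhds_eq, Filter.eventually_map]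
  filter_upwards [hiD] with y hy
  simpa using hy

end Gluing

/-! ### Existence of complexifications -/

section Existence

variable {q m : ℕ}
  {Q : Type*} [TopologicalSpace Q] [ChartedSpace (RModel q) Q]
  {M : Type*} [TopologicalSpace M] [ChartedSpace (CModel m) M]

theorem metrizableSpace_of_chartedSpace (m : ℕ) (M : Type*) [TopologicalSpace M]
    [ChartedSpace (CModel m) M] [T2Space M] [SecondCountableTopology M] :
    TopologicalSpace.MetrizableSpace M := by
  have : LocallyCompactSpace M := ChartedSpace.locallyCompactSpace (CModel m) M
  exact TopologicalSpace.metrizableSpace_of_t3_secondCountable M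

/-- A totally real submanifold is contained in a complex submanifold of the same dimension. -/
theorem exists_isSliced [IsManifold 𝓘(ℂ, CModel m) ω M] [TopologicalSpace.MetrizableSpace M] {r : ℕ}
    (hqr : q + r = m) {f : Q → M} (hf : IsTotallyRealEmbedding q m f) :
    ∃ X : Set M, IsSliced q r m X ∧ ∀ x, f x ∈ X := by
  choose Θ hΘ e had using fun x => exists_isAdaptedAt hqr (hf.contMDiff x) (hf.injective_cplx x)
  -- Because `f` is an embedding, a small neighbourhood of `f x` meets the image only in points `f
  -- y` with `y` near `x`; no distant part of `Q` returns there.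
  have hU : ∀ x, ∃ U : Set M, IsOpen U ∧ f x ∈ U ∧ U ⊆ (Θ x).source ∧
      ∀ y, f y ∈ U → IsAdaptedAt f (chartAt (RModel q) x) (Θ x) (e x) y := fun x => by
    have h1 := (had x).eventually
    rw [hf.isEmbedding.nhds_eq_comap, Filter.eventually_comap] at h1
    have h2 : ∀ᶠ z in 𝓝 (f x), z ∈ (Θ x).source :=
      (Θ x).open_source.mem_nhds (had x).2.self_of_nhds.1
    obtain ⟨U, hU, hUo, hxU⟩ := eventually_nhds_iff.1 (h1.and h2)
    exact ⟨U, hUo, hxU, fun z hz => (hU z hz).2, fun y hy => (hU _ hy).1 y rfl⟩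
  choose U hUo hxU hUΘ hUad using hU
  -- The glued object is a predicate, namely membership in the local slice.
  let D : Q → M → Prop := fun x z => ((e x).symm (Θ x z)).2 = 0
  -- The defining map of the second slice is holomorphic and vanishes along `f`, hence on the first
  -- slice. Exchanging the roles gives equality of the two germs.
  have hle : ∀ x x' y, f y ∈ U x → f y ∈ U x' → ∀ᶠ z in 𝓝 (f y), D x z → D x' z := by
    intro x x' y hy hy'
    have h1 : ContMDiffAt 𝓘(ℂ, CModel m) 𝓘(ℂ, CModel r) ω
        (fun z => ((e x').symm (Θ x' z)).2) (f y) :=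
      ContMDiffAt.comp (f y) (g := fun w : CModel m => ((e x').symm w).2) (f := Θ x')
        (I' := 𝓘(ℂ, CModel m))
        (show ContDiff ℂ ω (fun w : CModel m => ((e x').symm w).2) by
          fun_prop).contMDiff.contMDiffAt
        (contMDiffAt_of_mem_maximalAtlas (hΘ x') (hUΘ x' hy'))
    have h2 : ∀ᶠ y' in 𝓝 y, ((e x').symm (Θ x' (f y'))).2 = 0 := by
      filter_upwards [(hUad x' y hy').2] with y' h
      rw [h.2, (e x').symm_apply_apply]
    filter_upwards [eventually_eq_zero_on_slice (hΘ x) (hUad x y hy) h1 h2,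
      (hUo x).mem_nhds hy] with z hz hzU
    exact hz (hUΘ x hzU)
  obtain ⟨O, hO, hAO, D', hD'⟩ := exists_glued_germ (Set.range f) U hUo
    (by rintro _ ⟨x, rfl⟩; exact Set.mem_iUnion.2 ⟨x, hxU x⟩) D
    (by
      rintro x x' _ ⟨y, rfl⟩ hy hy'
      filter_upwards [hle x x' y hy hy', hle x' x y hy' hy] with z h1 h2
      exact propext ⟨h1, h2⟩)
  refine ⟨{z | z ∈ O ∧ D' z}, IsSliced.of_eventually fun z hz => ?_, fun x => ?_⟩
  · obtain ⟨x, hx, hxD⟩ := hD' z hz.1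
    refine ⟨Θ x, hΘ x, e x, hUΘ x hx, ?_⟩
    filter_upwards [hO.mem_nhds hz.1, hxD] with y h1 h2
    exact ⟨fun h => h2.mp h.2, fun h => ⟨h1, h2.mpr h⟩⟩
  · obtain ⟨x', hx', hxD⟩ := hD' (f x) (hAO ⟨x, rfl⟩)
    refine ⟨hAO ⟨x, rfl⟩, ?_⟩
    rw [hxD.self_of_nhds]
    simp only [D]
    rw [(hUad x' x hx').2.self_of_nhds.2, (e x').symm_apply_apply]

end Existence

/-! ### Algebra of mixed tensors -/

section Tensor

variable {𝕜 A B : Type*} [Field 𝕜] [AddCommGroup A] [Module 𝕜 A] [AddCommGroup B] [Module 𝕜 B]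
  {a b c d : ℕ} {α β : Type*}

/-- The product of `n` linear forms. -/
def prodForm {n : ℕ} (ε : Fin n → Module.Dual 𝕜 A) : MultilinearMap 𝕜 (fun _ : Fin n => A) 𝕜 :=
  (MultilinearMap.mkPiAlgebra 𝕜 (Fin n) 𝕜).compLinearMap ε

@[simp] lemma prodForm_apply {n : ℕ} (ε : Fin n → Module.Dual 𝕜 A) (u : Fin n → A) :
    prodForm ε u = ∏ i, ε i (u i) := by
  simp [prodForm]

/-- The decomposable mixed tensors. -/
def elemTensor (ε : Fin a → Module.Dual 𝕜 A) (w : Fin b → A) (η : Fin c → Module.Dual 𝕜 B)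
    (h : Fin d → B) : MixedTensor 𝕜 A B a b c d :=
  (prodForm ε).smulRight ((prodForm fun i => Module.Dual.eval 𝕜 A (w i)).smulRight
    ((prodForm η).smulRight (prodForm fun i => Module.Dual.eval 𝕜 B (h i))))

@[simp] lemma elemTensor_apply (ε : Fin a → Module.Dual 𝕜 A) (w : Fin b → A)
    (η : Fin c → Module.Dual 𝕜 B) (h : Fin d → B) (u : Fin a → A) (l : Fin b → Module.Dual 𝕜 A)
    (v : Fin c → B) (m : Fin d → Module.Dual 𝕜 B) :
    elemTensor ε w η h u l v m =
      (∏ i, ε i (u i)) * ((∏ i, l i (w i)) * ((∏ i, η i (v i)) * ∏ i, m i (h i))) := by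
  simp [elemTensor]

lemma MixedTensor.ext_basis [Finite α] [Finite β] (bA : Module.Basis α 𝕜 A)
    (bB : Module.Basis β 𝕜 B) {T T' : MixedTensor 𝕜 A B a b c d}
    (h : ∀ (i : Fin a → α) (j : Fin b → α) (k : Fin c → β) (l : Fin d → β),
      T (fun t => bA (i t)) (fun t => bA.coord (j t)) (fun t => bB (k t))
          (fun t => bB.coord (l t)) =
        T' (fun t => bA (i t)) (fun t => bA.coord (j t)) (fun t => bB (k t))
          (fun t => bB.coord (l t))) : T = T' := by
  classical
  refine Module.Basis.ext_multilinear (fun _ => bA) fun i => ?_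
  refine Module.Basis.ext_multilinear (fun _ => bA.dualBasis) fun j => ?_
  refine Module.Basis.ext_multilinear (fun _ => bB) fun k => ?_
  refine Module.Basis.ext_multilinear (fun _ => bB.dualBasis) fun l => ?_
  simpa using h i j k l

/-- The indices of the components of a mixed tensor. -/
abbrev TensorIndex (α β : Type*) (a b c d : ℕ) : Type _ :=
  (Fin a → α) × (Fin b → α) × (Fin c → β) × (Fin d → β)

/-- The components of a mixed tensor with respect to bases. -/
def MixedTensor.component (bA : Module.Basis α 𝕜 A) (bB : Module.Basis β 𝕜 B)
    (T : MixedTensor 𝕜 A B a b c d) (I : TensorIndex α β a b c d) : 𝕜 :=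
  T (fun t => bA (I.1 t)) (fun t => bA.coord (I.2.1 t)) (fun t => bB (I.2.2.1 t))
    (fun t => bB.coord (I.2.2.2 t))

lemma prod_coord [DecidableEq α] (bA : Module.Basis α 𝕜 A) {n : ℕ} (i j : Fin n → α) :
    ∏ t, bA.coord (i t) (bA (j t)) = if i = j then 1 else 0 := by
  split_ifs with h
  · subst h
    simp
  · obtain ⟨t, ht⟩ := Function.ne_iff.1 h
    refine Finset.prod_eq_zero (Finset.mem_univ t) ?_
    simp [Ne.symm ht]

lemma MixedTensor.sum_component [Fintype α] [Fintype β] (bA : Module.Basis α 𝕜 A)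
    (bB : Module.Basis β 𝕜 B) (T : MixedTensor 𝕜 A B a b c d) :
    ∑ I : TensorIndex α β a b c d, T.component bA bB I •
      elemTensor (fun t => bA.coord (I.1 t)) (fun t => bA (I.2.1 t))
        (fun t => bB.coord (I.2.2.1 t)) (fun t => bB (I.2.2.2 t)) = T := by
  classical
  refine MixedTensor.ext_basis bA bB fun i j k l => ?_
  simp only [_root_.sum_apply, _root_.smul_apply, elemTensor_apply, prod_coord]
  rw [Finset.sum_eq_single (i, j, k, l)]
  · simp [MixedTensor.component]
  · rintro ⟨i', j', k', l'⟩ - hne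
    by_cases h1 : i' = i
    · by_cases h2 : j = j'
      · by_cases h3 : k' = k
        · by_cases h4 : l = l'
          · exact absurd (by rw [h1, h2, h3, h4]) hne
          · simp [h4]
        · simp [h3]
      · simp [h2]
    · simp [h1]
  · simp

/-- The action of a decomposition of a real mixed tensor on complexified arguments. -/
lemma sum_elemTensor_eq_ofReal [Fintype α] [Fintype β] {A B : Type*}
    [AddCommGroup A] [Module ℝ A] [AddCommGroup B] [Module ℝ B]
    {A' B' : Type*} [AddCommGroup A'] [Module ℂ A'] [AddCommGroup B'] [Module ℂ B']
    (bA : Module.Basis α ℝ A) (bB : Module.Basis β ℝ B) (T : MixedTensor ℝ A B a b c d)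
    (ε : α → Module.Dual ℂ A') (w : α → A') (η : β → Module.Dual ℂ B') (h : β → B')
    {u : Fin a → A} {l : Fin b → Module.Dual ℝ A} {v : Fin c → B} {m : Fin d → Module.Dual ℝ B}
    {u' : Fin a → A'} {l' : Fin b → Module.Dual ℂ A'} {v' : Fin c → B'}
    {m' : Fin d → Module.Dual ℂ B'}
    (hu : ∀ i t, ε i (u' t) = (bA.coord i (u t) : ℝ)) (hl : ∀ i t, l' t (w i) = (l t (bA i) : ℝ))
    (hv : ∀ i t, η i (v' t) = (bB.coord i (v t) : ℝ)) (hm : ∀ i t, m' t (h i) = (m t (bB i) : ℝ)) :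
    (∑ I : TensorIndex α β a b c d, ((T.component bA bB I : ℝ) : ℂ) •
      elemTensor (fun t => ε (I.1 t)) (fun t => w (I.2.1 t))
        (fun t => η (I.2.2.1 t)) (fun t => h (I.2.2.2 t))) u' l' v' m' = (T u l v m : ℝ) := by
  conv_rhs => rw [← MixedTensor.sum_component bA bB T]
  simp only [_root_.sum_apply, _root_.smul_apply, elemTensor_apply, hu, hl, hv, hm]
  simp

end Tensor

/-! ### Coordinates on tangent spaces -/

section Coordinates

variable (𝕜 : Type*) [NontriviallyNormedField 𝕜]
  {A : Type*} [NormedAddCommGroup A] [NormedSpace 𝕜 A]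
  {Y : Type*} [TopologicalSpace Y] [ChartedSpace A Y] [IsManifold 𝓘(𝕜, A) ω Y]

/-- The coordinates at `y₀` of the tangent vectors at `y`. -/
def toCoord (y₀ y : Y) : A →L[𝕜] A :=
  (trivializationAt A (TangentSpace 𝓘(𝕜, A)) y₀).continuousLinearMapAt 𝕜 y

/-- The tangent vector at `y` with given coordinates at `y₀`. -/
def ofCoord (y₀ y : Y) : A →L[𝕜] A :=
  (trivializationAt A (TangentSpace 𝓘(𝕜, A)) y₀).symmL 𝕜 y

variable {𝕜}

lemma toCoord_ofCoord {y₀ y : Y} (h : y ∈ (chartAt A y₀).source) (v : A) :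
    toCoord 𝕜 y₀ y (ofCoord 𝕜 y₀ y v) = v :=
  Bundle.Trivialization.continuousLinearMapAt_symmL
    (trivializationAt A (TangentSpace 𝓘(𝕜, A)) y₀) h v

lemma ofCoord_toCoord {y₀ y : Y} (h : y ∈ (chartAt A y₀).source) (v : A) :
    ofCoord 𝕜 y₀ y (toCoord 𝕜 y₀ y v) = v :=
  Bundle.Trivialization.symmL_continuousLinearMapAt
    (trivializationAt A (TangentSpace 𝓘(𝕜, A)) y₀) h v

variable (𝕜) in
/-- The coordinates at `y₀`, as a linear isomorphism. -/
def coordEquiv {y₀ y : Y} (h : y ∈ (chartAt A y₀).source) : A ≃ₗ[𝕜] A where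
  __ := (toCoord (A := A) 𝕜 y₀ y).toLinearMap
  invFun := ofCoord (A := A) 𝕜 y₀ y
  left_inv := ofCoord_toCoord (A := A) h
  right_inv := toCoord_ofCoord (A := A) h

/-- This is the coordinate change of the tangent bundle. It is needed because local frames are
written in the chart at a fixed point, while analyticity at `z` is tested in the chart at `z`. -/
lemma contMDiffAt_toCoord_comp_ofCoord {y₁ y₂ y : Y} (h₁ : y ∈ (chartAt A y₁).source)
    (h₂ : y ∈ (chartAt A y₂).source) :
    ContMDiffAt 𝓘(𝕜, A) 𝓘(𝕜, A →L[𝕜] A) ω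
      (fun z => (toCoord (A := A) 𝕜 y₁ z).comp (ofCoord (A := A) 𝕜 y₂ z)) y := by
  have h := contMDiffAt_coordChangeL (n := ω) (IB := 𝓘(𝕜, A))
    (e := trivializationAt A (TangentSpace 𝓘(𝕜, A) : Y → Type _) y₂)
    (e' := trivializationAt A (TangentSpace 𝓘(𝕜, A) : Y → Type _) y₁) (x := y) h₂ h₁
  refine h.congr_of_eventuallyEq ?_
  filter_upwards [(chartAt A y₁).open_source.mem_nhds h₁,
    (chartAt A y₂).open_source.mem_nhds h₂] with z hz₁ hz₂
  ext v
  have h1 := Bundle.Trivialization.symmL_apply (R := 𝕜)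
    (trivializationAt A (TangentSpace 𝓘(𝕜, A) : Y → Type _) y₂) hz₂ v
  have h2 := Bundle.Trivialization.continuousLinearMapAt_apply_of_mem 𝕜
    (trivializationAt A (TangentSpace 𝓘(𝕜, A) : Y → Type _) y₁) hz₁
    (show A from ofCoord (A := A) 𝕜 y₂ z v)
  refine Eq.trans (h2.trans ?_)
    (Bundle.Trivialization.coordChangeL_apply (R := 𝕜) _ _ ⟨hz₂, hz₁⟩ v).symm
  exact congrArg (fun w => (trivializationAt A (TangentSpace 𝓘(𝕜, A) : Y → Type _) y₁
    ⟨z, w⟩).2) h1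

lemma toCoord_self (y : Y) (v : A) : toCoord (A := A) 𝕜 y y v = v := by
  have h : y ∈ (chartAt A y).source := mem_chart_source A y
  have h1 := TangentBundle.continuousLinearMapAt_trivializationAt (I := 𝓘(𝕜, A)) h
  rw [mfderiv_extChartAt_self] at h1
  exact congrArg (fun T : A →L[𝕜] A => T v) h1

end Coordinates

/-- Both sides are the differential of the chart at `y₀`, taken over `ℝ` and over `ℂ`. -/
lemma toCoord_real {E : Type*} [NormedAddCommGroup E] [NormedSpace ℂ E]
    {Y : Type*} [TopologicalSpace Y] [ChartedSpace E Y] [IsManifold 𝓘(ℂ, E) ω Y]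
    [IsManifold 𝓘(ℝ, E) ω Y] {y₀ y : Y} (h : y ∈ (chartAt E y₀).source) (v : E) :
    toCoord ℝ y₀ y v = toCoord ℂ y₀ y v := by
  have h1 := TangentBundle.continuousLinearMapAt_trivializationAt (I := 𝓘(ℝ, E)) h
  have h2 := TangentBundle.continuousLinearMapAt_trivializationAt (I := 𝓘(ℂ, E)) h
  have h3 := (mfderiv_real (mdifferentiableAt_extChartAt (I := 𝓘(ℂ, E)) h)).2 v
  refine (congrArg (fun T : E →L[ℝ] E => T v) h1).trans (Eq.trans ?_
    (congrArg (fun T : E →L[ℂ] E => T v) h2).symm)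
  exact h3

/-! ### Analytic tensor fields -/

section Analytic

variable {𝕜 : Type*} [NontriviallyNormedField 𝕜]
  {A : Type*} [NormedAddCommGroup A] [NormedSpace 𝕜 A]
  {B : Type*} [NormedAddCommGroup B] [NormedSpace 𝕜 B]
  {S : Type*} [TopologicalSpace S] [ChartedSpace A S]
  {Y : Type*} [TopologicalSpace Y] [ChartedSpace B Y]
  {a b c d : ℕ} {f : S → Y} {x₀ : S}

lemma contMDiffAt_prod_scalar {ι : Type*} {t : Finset ι} {g : ι → S → 𝕜}
    (h : ∀ i ∈ t, ContMDiffAt 𝓘(𝕜, A) 𝓘(𝕜, 𝕜) ω (g i) x₀) :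
    ContMDiffAt 𝓘(𝕜, A) 𝓘(𝕜, 𝕜) ω (fun x => ∏ i ∈ t, g i x) x₀ := by
  classical
  induction t using Finset.induction_on with
  | empty => simpa using contMDiffAt_const
  | insert i t hi ih =>
    simp only [Finset.prod_insert hi]
    exact (h i (Finset.mem_insert_self i t)).mul
      (ih fun k hk => h k (Finset.mem_insert_of_mem hk))

lemma contMDiffAt_sum_scalar {ι : Type*} {t : Finset ι} {g : ι → S → 𝕜}
    (h : ∀ i ∈ t, ContMDiffAt 𝓘(𝕜, A) 𝓘(𝕜, 𝕜) ω (g i) x₀) :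
    ContMDiffAt 𝓘(𝕜, A) 𝓘(𝕜, 𝕜) ω (fun x => ∑ i ∈ t, g i x) x₀ := by
  classical
  induction t using Finset.induction_on with
  | empty => simpa using contMDiffAt_const
  | insert i t hi ih =>
    simp only [Finset.sum_insert hi]
    exact (h i (Finset.mem_insert_self i t)).add
      (ih fun k hk => h k (Finset.mem_insert_of_mem hk))

variable [IsManifold 𝓘(𝕜, A) ω S] [IsManifold 𝓘(𝕜, B) ω Y]

/-- The tensor field `D` along `f` is analytic at `x₀`. -/
def IsAnalyticTensorAt (f : S → Y) (D : S → MixedTensor 𝕜 A B a b c d) (x₀ : S) : Prop :=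
  ∀ (u : Fin a → A) (l : Fin b → Module.Dual 𝕜 A) (v : Fin c → B) (m : Fin d → Module.Dual 𝕜 B),
    ContMDiffAt 𝓘(𝕜, A) 𝓘(𝕜, 𝕜) ω (fun x : S =>
      D x (fun i => ofCoord 𝕜 x₀ x (u i)) (fun i => (l i).comp (toCoord 𝕜 x₀ x).toLinearMap)
        (fun i => ofCoord 𝕜 (f x₀) (f x) (v i))
        (fun i => (m i).comp (toCoord 𝕜 (f x₀) (f x)).toLinearMap)) x₀

lemma isAnalytic_iff {F : TensorFieldAlong 𝕜 A B f a b c d} :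
    F.IsAnalytic ↔ ∀ x₀, IsAnalyticTensorAt f F x₀ := Iff.rfl

lemma IsAnalyticTensorAt.congr {D D' : S → MixedTensor 𝕜 A B a b c d}
    (h : IsAnalyticTensorAt f D x₀) (hD : D' =ᶠ[𝓝 x₀] D) : IsAnalyticTensorAt f D' x₀ :=
  fun u l v m => (h u l v m).congr_of_eventuallyEq (hD.mono fun x hx => by simp only [hx])

lemma MixedTensor.eq_of_add_neg_smul_eq_zero {D D' : MixedTensor 𝕜 A B a b c d}
    (h : D + (-1 : 𝕜) • D' = 0) : D = D' := by
  ext u l v m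
  have := congrArg (fun T : MixedTensor 𝕜 A B a b c d => T u l v m) h
  simpa [← sub_eq_add_neg, sub_eq_zero] using this

lemma IsAnalyticTensorAt.sub {D D' : S → MixedTensor 𝕜 A B a b c d}
    (h : IsAnalyticTensorAt f D x₀) (h' : IsAnalyticTensorAt f D' x₀) :
    IsAnalyticTensorAt f (fun x => D x + (-1 : 𝕜) • D' x) x₀ :=
  fun u l v m => (h u l v m).add (contMDiffAt_const.mul (h' u l v m))

/-- A combination of frame fields with analytic coefficients is analytic. -/
lemma isAnalyticTensorAt_sum {α β : Type*} [Fintype α] [Fintype β]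
    {C : TensorIndex α β a b c d → S → 𝕜} {ε : α → S → Module.Dual 𝕜 A} {w : α → S → A}
    {η : β → S → Module.Dual 𝕜 B} {h : β → S → B}
    (hC : ∀ I, ContMDiffAt 𝓘(𝕜, A) 𝓘(𝕜, 𝕜) ω (C I) x₀)
    (hε : ∀ i u, ContMDiffAt 𝓘(𝕜, A) 𝓘(𝕜, 𝕜) ω (fun x => ε i x (ofCoord 𝕜 x₀ x u)) x₀)
    (hw : ∀ i (l : Module.Dual 𝕜 A),
      ContMDiffAt 𝓘(𝕜, A) 𝓘(𝕜, 𝕜) ω (fun x => l (toCoord 𝕜 x₀ x (w i x))) x₀)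
    (hη : ∀ i u, ContMDiffAt 𝓘(𝕜, A) 𝓘(𝕜, 𝕜) ω
      (fun x => η i x (ofCoord 𝕜 (f x₀) (f x) u)) x₀)
    (hh : ∀ i (l : Module.Dual 𝕜 B),
      ContMDiffAt 𝓘(𝕜, A) 𝓘(𝕜, 𝕜) ω (fun x => l (toCoord 𝕜 (f x₀) (f x) (h i x))) x₀) :
    IsAnalyticTensorAt f (fun x => ∑ I : TensorIndex α β a b c d, C I x •
      elemTensor (fun t => ε (I.1 t) x) (fun t => w (I.2.1 t) x)
        (fun t => η (I.2.2.1 t) x) (fun t => h (I.2.2.2 t) x)) x₀ := by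
  intro u l v m
  simp only [_root_.sum_apply, _root_.smul_apply, elemTensor_apply, smul_eq_mul]
  refine contMDiffAt_sum_scalar fun I _ => (hC I).mul ?_
  refine (contMDiffAt_prod_scalar fun t _ => hε _ _).mul ?_
  refine (contMDiffAt_prod_scalar fun t _ => hw _ _).mul ?_
  exact (contMDiffAt_prod_scalar fun t _ => hη _ _).mul (contMDiffAt_prod_scalar fun t _ => hh _ _)

/-- An analytic tensor field vanishes exactly where finitely many analytic functions do. -/
lemma IsAnalyticTensorAt.exists_components [FiniteDimensional 𝕜 A] [FiniteDimensional 𝕜 B]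
    {D : S → MixedTensor 𝕜 A B a b c d} (h : IsAnalyticTensorAt f D x₀)
    (hf : ContinuousAt f x₀) :
    ∃ (ι : Type) (_ : Finite ι) (g : ι → S → 𝕜),
      (∀ i, ContMDiffAt 𝓘(𝕜, A) 𝓘(𝕜, 𝕜) ω (g i) x₀) ∧ (∀ i x, D x = 0 → g i x = 0) ∧
      ∀ᶠ x in 𝓝 x₀, (∀ i, g i x = 0) → D x = 0 := by
  let bA := Module.finBasis 𝕜 A
  let bB := Module.finBasis 𝕜 B
  refine ⟨TensorIndex (Fin (Module.finrank 𝕜 A)) (Fin (Module.finrank 𝕜 B)) a b c d,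
    inferInstance, fun I x =>
      D x (fun i => ofCoord 𝕜 x₀ x (bA (I.1 i)))
        (fun i => (bA.coord (I.2.1 i)).comp (toCoord 𝕜 x₀ x).toLinearMap)
        (fun i => ofCoord 𝕜 (f x₀) (f x) (bB (I.2.2.1 i)))
        (fun i => (bB.coord (I.2.2.2 i)).comp (toCoord 𝕜 (f x₀) (f x)).toLinearMap),
    fun I => h _ _ _ _, fun I x hx => by simp [hx], ?_⟩
  filter_upwards [(chartAt A x₀).open_source.mem_nhds (mem_chart_source A x₀),
    hf.eventually ((chartAt B (f x₀)).open_source.mem_nhds (mem_chart_source B (f x₀)))]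
    with x hx hfx h0
  -- The functions `g` are the components of `D x` in the bases obtained by transporting `bA` and
  -- `bB` from the charts at `x₀` and `f x₀`.
  refine MixedTensor.ext_basis (bA.map (coordEquiv 𝕜 hx).symm) (bB.map (coordEquiv 𝕜 hfx).symm)
    fun i j k l => ?_
  exact h0 (i, j, k, l)

end Analytic

/-! ### Frames along totally real submanifolds -/

section Frames

lemma ofCoord_self {A : Type*} [NormedAddCommGroup A] [NormedSpace ℝ A]
    {Y : Type*} [TopologicalSpace Y] [ChartedSpace A Y] [IsManifold 𝓘(ℝ, A) ω Y]
    (y : Y) (v : A) : ofCoord (A := A) ℝ y y v = v := by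
  have h := ofCoord_toCoord (𝕜 := ℝ) (mem_chart_source A y) v
  rwa [toCoord_self] at h

variable {k m : ℕ} {S : Type*} [TopologicalSpace S] [ChartedSpace (RModel k) S]
  [IsManifold (𝓡 k) ω S] {Y : Type*} [TopologicalSpace Y] [ChartedSpace (CModel m) Y]
  [IsManifold 𝓘(ℝ, CModel m) ω Y]

/-- A real linear map between tangent spaces, in coordinates. -/
def inCoord (x₀ x : S) (y₀ y : Y) (T : RModel k →L[ℝ] CModel m) : RModel k →L[ℝ] CModel m :=
  (toCoord ℝ y₀ y).comp (T.comp (ofCoord ℝ x₀ x))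

lemma inCoord_self (x : S) (y : Y) (T : RModel k →L[ℝ] CModel m) : inCoord x x y y T = T := by
  ext1 v
  simp only [inCoord, ContinuousLinearMap.comp_apply, ofCoord_self]
  exact toCoord_self y _

variable [IsManifold 𝓘(ℂ, CModel m) ω Y] {x₀ x : S} {y₀ y : Y} {T : RModel k →L[ℝ] CModel m}

/-- The coordinate expression of `T`, unlike `T` itself, is what gets extended holomorphically off
the real points; this identity and the next return from it to tangent vectors. -/
lemma toCoord_eq_cplx_inCoord (hx : x ∈ (chartAt (RModel k) x₀).source)
    (hy : y ∈ (chartAt (CModel m) y₀).source) (u : RModel k) :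
    toCoord ℂ y₀ y (T u) = cplx (inCoord x₀ x y₀ y T) (realIncl k (toCoord ℝ x₀ x u)) := by
  rw [cplx_realIncl, ← toCoord_real hy]
  simp only [inCoord, ContinuousLinearMap.comp_apply]
  rw [ofCoord_toCoord hx]

lemma ofCoord_cplx_inCoord (hy : y ∈ (chartAt (CModel m) y₀).source) (v : RModel k) :
    ofCoord ℂ y₀ y (cplx (inCoord x₀ x y₀ y T) (realIncl k v)) = T (ofCoord ℝ x₀ x v) := by
  rw [cplx_realIncl]
  simp only [inCoord, ContinuousLinearMap.comp_apply]
  rw [toCoord_real hy, ofCoord_toCoord hy]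

end Frames

/-! ### Inverses of holomorphic families of linear maps -/

section InverseFamily

variable {A V W : Type*} [NormedAddCommGroup A] [NormedSpace ℂ A]
  [NormedAddCommGroup V] [NormedSpace ℂ V] [CompleteSpace V]
  [NormedAddCommGroup W] [NormedSpace ℂ W]
  {X : Type*} [TopologicalSpace X] [ChartedSpace A X] {z₀ : X} {T : X → V →L[ℂ] W}

lemma contMDiffAt_inverse (hT : ContMDiffAt 𝓘(ℂ, A) 𝓘(ℂ, V →L[ℂ] W) ω T z₀)
    (e : V ≃L[ℂ] W) (he : T z₀ = e) :
    ContMDiffAt 𝓘(ℂ, A) 𝓘(ℂ, W →L[ℂ] V) ω (fun z => (T z).inverse) z₀ := by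
  refine ContMDiffAt.comp z₀ (g := ContinuousLinearMap.inverse) (f := T)
    (I' := 𝓘(ℂ, V →L[ℂ] W)) ?_ hT
  rw [he]
  exact (contDiffAt_map_inverse e).contMDiffAt

/-- Invertible maps form an open set, so near `z₀` the total function `inverse` is a true inverse
and not its default value. -/
lemma eventually_inverse_apply (hT : ContinuousAt T z₀) (e : V ≃L[ℂ] W) (he : T z₀ = e) :
    ∀ᶠ z in 𝓝 z₀, ∀ v, (T z).inverse (T z v) = v := by
  have h := hT.eventually (p := fun L => L ∈ Set.range ((↑) : (V ≃L[ℂ] W) → V →L[ℂ] W))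
    (by rw [he]; exact e.nhds)
  filter_upwards [h] with z ⟨e', he'⟩ v
  rw [← he', ContinuousLinearMap.inverse_equiv]
  simp

end InverseFamily

/-! ### Holomorphic frames and coframes -/

section FrameAnalytic

variable {A B V : Type*} [NormedAddCommGroup A] [NormedSpace ℂ A]
  [NormedAddCommGroup B] [NormedSpace ℂ B] [NormedAddCommGroup V] [NormedSpace ℂ V]
  {X : Type*} [TopologicalSpace X] [ChartedSpace A X]
  {Y : Type*} [TopologicalSpace Y] [ChartedSpace B Y] [IsManifold 𝓘(ℂ, B) ω Y]
  {f : X → Y} {z : X} {y₀ : Y}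

lemma contMDiffAt_coframe (hf : ContMDiffAt 𝓘(ℂ, A) 𝓘(ℂ, B) ω f z)
    (hz : f z ∈ (chartAt B y₀).source) {T : X → B →L[ℂ] V}
    (hT : ContMDiffAt 𝓘(ℂ, A) 𝓘(ℂ, B →L[ℂ] V) ω T z) (l : V →L[ℂ] ℂ) (u : B) :
    ContMDiffAt 𝓘(ℂ, A) 𝓘(ℂ, ℂ) ω
      (fun x => l (T x (toCoord ℂ y₀ (f x) (ofCoord ℂ (f z) (f x) u)))) z := by
  have h := (contMDiffAt_toCoord_comp_ofCoord (𝕜 := ℂ) hz (mem_chart_source B (f z))).comp z hf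
  exact ContMDiffAt.clm_apply contMDiffAt_const
    (hT.clm_apply (h.clm_apply (contMDiffAt_const (c := u))))

lemma contMDiffAt_frame [FiniteDimensional ℂ B] (hf : ContMDiffAt 𝓘(ℂ, A) 𝓘(ℂ, B) ω f z)
    (hz : f z ∈ (chartAt B y₀).source) {T : X → V →L[ℂ] B}
    (hT : ContMDiffAt 𝓘(ℂ, A) 𝓘(ℂ, V →L[ℂ] B) ω T z) (l : Module.Dual ℂ B) (v : V) :
    ContMDiffAt 𝓘(ℂ, A) 𝓘(ℂ, ℂ) ω
      (fun x => l (toCoord ℂ (f z) (f x) (ofCoord ℂ y₀ (f x) (T x v)))) z := by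
  have h := (contMDiffAt_toCoord_comp_ofCoord (𝕜 := ℂ) (mem_chart_source B (f z)) hz).comp z hf
  exact ContMDiffAt.clm_apply (g := fun _ => LinearMap.toContinuousLinearMap l) contMDiffAt_const
    (h.clm_apply (hT.clm_apply (contMDiffAt_const (c := v))))

end FrameAnalytic

/-! ### Holomorphic extensions of tensors at a point -/

section ExtendsAt

variable {s p n : ℕ} {a b c d : ℕ}

/-- The complex tensor `T'` is the complex multilinear extension of the real tensor `T`, with
respect to the real linear maps `A : ℝˢ → ℂˢ` and `B : ℝᵖ → ℂⁿ`. -/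
def ExtendsTensor (A : RModel s →L[ℝ] CModel s) (B : RModel p →L[ℝ] CModel n)
    (T' : MixedTensor ℂ (CModel s) (CModel n) a b c d)
    (T : MixedTensor ℝ (RModel s) (RModel p) a b c d) : Prop :=
  ∀ (u : Fin a → RModel s) (l : Fin b → Module.Dual ℝ (RModel s))
    (v : Fin c → RModel p) (m : Fin d → Module.Dual ℝ (RModel p))
    (L : Fin b → Module.Dual ℂ (CModel s)) (N : Fin d → Module.Dual ℂ (CModel n)),
    (∀ i w, L i (A w) = (l i w : ℂ)) → (∀ i w, N i (B w) = (m i w : ℂ)) →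
    T' (fun i => A (u i)) L (fun i => B (v i)) N = ((T u l v m : ℝ) : ℂ)

/-- The complex basis given by a real linear map with bijective complex extension. -/
def cplxBasis {k m : ℕ} {A : RModel k →L[ℝ] CModel m} (hA : Function.Bijective (cplx A)) :
    Module.Basis (Fin k) ℂ (CModel m) :=
  (EuclideanSpace.basisFun (Fin k) ℂ).toBasis.map
    (LinearEquiv.ofBijective (cplx A).toLinearMap hA)

lemma single_eq_realIncl {k : ℕ} (i : Fin k) :
    EuclideanSpace.single i (1 : ℂ) = realIncl k (EuclideanSpace.single i 1) := by
  ext t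
  by_cases h : t = i <;> simp [h]

lemma cplxBasis_apply {k m : ℕ} {A : RModel k →L[ℝ] CModel m} (hA : Function.Bijective (cplx A))
    (i : Fin k) : cplxBasis hA i = A (EuclideanSpace.single i 1) := by
  rw [← cplx_realIncl, ← single_eq_realIncl]
  simp [cplxBasis]

lemma cplxBasis_coord {k m : ℕ} {A : RModel k →L[ℝ] CModel m} (hA : Function.Bijective (cplx A))
    (i : Fin k) (w : RModel k) : (cplxBasis hA).coord i (A w) = (w i : ℂ) := by
  have : A w = LinearEquiv.ofBijective (cplx A).toLinearMap hA (realIncl k w) := by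
    simp
  rw [this]
  simp [cplxBasis, -LinearEquiv.ofBijective_apply]

/-- The images of the standard real bases are complex bases, and their coordinate forms extend the
real ones. All components of an extension are thus prescribed by `T`. -/
lemma ExtendsTensor.unique {A : RModel s →L[ℝ] CModel s} {B : RModel p →L[ℝ] CModel n}
    (hA : Function.Bijective (cplx A)) (hB : Function.Bijective (cplx B))
    {T' T'' : MixedTensor ℂ (CModel s) (CModel n) a b c d}
    {T : MixedTensor ℝ (RModel s) (RModel p) a b c d} (h' : ExtendsTensor A B T' T)
    (h'' : ExtendsTensor A B T'' T) : T' = T'' := by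
  refine MixedTensor.ext_basis (cplxBasis hA) (cplxBasis hB) fun i j k l => ?_
  simp only [cplxBasis_apply]
  let pr (k : ℕ) (t : Fin k) : Module.Dual ℝ (RModel k) :=
    (EuclideanSpace.proj t : RModel k →L[ℝ] ℝ).toLinearMap
  rw [h' _ (fun t => pr s (j t)) _ (fun t => pr p (l t)) _ _
      (fun t w => by rw [cplxBasis_coord]; rfl) (fun t w => by rw [cplxBasis_coord]; rfl),
    h'' _ (fun t => pr s (j t)) _ (fun t => pr p (l t)) _ _
      (fun t w => by rw [cplxBasis_coord]; rfl) (fun t w => by rw [cplxBasis_coord]; rfl)]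

lemma extendsTensor_zero (A : RModel s →L[ℝ] CModel s) (B : RModel p →L[ℝ] CModel n) :
    ExtendsTensor A B (0 : MixedTensor ℂ (CModel s) (CModel n) a b c d) 0 := by
  intro u l v m L N _ _
  simp

end ExtendsAt

/-! ### Local holomorphic extensions of tensor fields -/

section Coordinates

variable {k m : ℕ} {S : Type*} [TopologicalSpace S] [ChartedSpace (RModel k) S]
  [IsManifold (𝓡 k) ω S]

/-- The coordinate frame of a chart. -/
def frameBasis {x₀ x : S} (hx : x ∈ (chartAt (RModel k) x₀).source) :
    Module.Basis (Fin k) ℝ (RModel k) :=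
  (EuclideanSpace.basisFun (Fin k) ℝ).toBasis.map (coordEquiv ℝ hx).symm

lemma frameBasis_apply {x₀ x : S} (hx : x ∈ (chartAt (RModel k) x₀).source) (i : Fin k) :
    frameBasis hx i = ofCoord ℝ x₀ x (EuclideanSpace.single i 1) := by
  simp only [frameBasis, Module.Basis.map_apply, OrthonormalBasis.coe_toBasis,
    EuclideanSpace.basisFun_apply]
  rfl

lemma frameBasis_coord {x₀ x : S} (hx : x ∈ (chartAt (RModel k) x₀).source) (i : Fin k) :
    (frameBasis hx).coord i = (EuclideanSpace.proj i : RModel k →L[ℝ] ℝ).toLinearMap.comp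
      (toCoord ℝ x₀ x).toLinearMap := by
  ext1 v
  simp only [frameBasis, Module.Basis.coord_apply, Module.Basis.map_repr, LinearEquiv.symm_symm,
    LinearEquiv.trans_apply]
  rfl

variable {p : ℕ} {P : Type*} [TopologicalSpace P] [ChartedSpace (RModel p) P]
  [IsManifold (𝓡 p) ω P]
  {Y : Type*} [TopologicalSpace Y] [ChartedSpace (CModel m) Y]
  [IsManifold 𝓘(ℝ, CModel m) ω Y]

/-- The differential of an analytic map, pulled back and in coordinates, is analytic. -/
lemma contMDiffAt_cplx_inCoord {g : P → Y} {i : S → P} {x₀ : S}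
    (hg : ContMDiffAt (𝓡 p) 𝓘(ℝ, CModel m) ω g (i x₀)) (hi : ContMDiffAt (𝓡 k) (𝓡 p) ω i x₀) :
    ContMDiffAt (𝓡 k) 𝓘(ℝ, CModel p →L[ℂ] CModel m) ω (fun x =>
      cplx (inCoord (i x₀) (i x) (g (i x₀)) (g (i x)) (realDifferential p m g (i x)))) x₀ := by
  have h1 : ContMDiffAt ((𝓡 k).prod (𝓡 p)) 𝓘(ℝ, CModel m) ω
      (Function.uncurry fun (_ : S) (y : P) => g y) (x₀, i x₀) :=
    ContMDiffAt.comp (x₀, i x₀) (g := g) (f := Prod.snd) hg contMDiffAt_snd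
  -- The family is constant in its parameter, which serves only to evaluate the differential at the
  -- moving point `i x`. No regularity is lost at order `ω`.
  have h2 := h1.mfderiv (fun _ => g) i hi (m := ω) (by simp)
  exact (cplxL p m).contMDiff.contMDiffAt.comp x₀ h2

end Coordinates

section Local

variable {s p n : ℕ} {a b c d : ℕ}
  {S : Type*} [TopologicalSpace S] [ChartedSpace (RModel s) S] [IsManifold (𝓡 s) ω S]
  {P : Type*} [TopologicalSpace P] [ChartedSpace (RModel p) P] [IsManifold (𝓡 p) ω P]
  {X : Type*} [TopologicalSpace X] [ChartedSpace (CModel s) X] [IsManifold 𝓘(ℂ, CModel s) ω X]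
  {M : Type*} [TopologicalSpace M] [ChartedSpace (CModel n) M] [IsManifold 𝓘(ℂ, CModel n) ω M]
  {ιS : S → P} {ιP : P → M} {j : S → X} {κ : X → M}

/-- The extension equals `T x₀` at `j x₀`, so it is invertible there, and its inverse is holomorphic
nearby. -/
lemma exists_invertible_extension {k m : ℕ} {x₀ : S}
    (hj : ContMDiffAt (𝓡 s) 𝓘(ℝ, CModel s) ω j x₀)
    (hjA : Function.Injective (cplx (realDifferential s s j x₀)))
    {T : S → CModel k →L[ℂ] CModel m}
    (hT : ContMDiffAt (𝓡 s) 𝓘(ℝ, CModel k →L[ℂ] CModel m) ω T x₀)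
    (hbij : Function.Bijective (T x₀)) :
    ∃ H : X → CModel k →L[ℂ] CModel m,
      (∀ᶠ z in 𝓝 (j x₀), ContMDiffAt 𝓘(ℂ, CModel s) 𝓘(ℂ, CModel k →L[ℂ] CModel m) ω H z ∧
        ContMDiffAt 𝓘(ℂ, CModel s) 𝓘(ℂ, CModel m →L[ℂ] CModel k) ω (fun z => (H z).inverse) z ∧
        ∀ v, (H z).inverse (H z v) = v) ∧
      ∀ᶠ x in 𝓝 x₀, H (j x) = T x := by
  obtain ⟨H, hH, hHT⟩ := exists_holomorphic_extension_of_totallyReal hj hjA hT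
  let e : CModel k ≃L[ℂ] CModel m :=
    (LinearEquiv.ofBijective (T x₀).toLinearMap hbij).toContinuousLinearEquiv
  have he : H (j x₀) = e := by
    rw [hHT.self_of_nhds]
    rfl
  have h1 := contMDiffAt_inverse hH e he
  refine ⟨H, ?_, hHT⟩
  rw [contMDiffAt_iff_contMDiffAt_nhds (by simp)] at h1
  have h2 := (contMDiffAt_iff_contMDiffAt_nhds (by simp)).1 hH
  exact h2.and (h1.and (eventually_inverse_apply hH.continuousAt e he))

/-- The components of `F` in coordinate frames of `S` and `P` extend holomorphically to `X`. So do
the coordinate matrices `𝒜` and `ℬ` of the complexified differentials of `j` and `ιP`. Their columns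
give holomorphic frames of `TX` and of `TM` along `κ`, and the rows of their inverses give the dual
coframes. The extended components in these frames define `D`. -/
theorem exists_local_extension (hP : ContMDiff (𝓡 p) 𝓘(ℝ, CModel n) ω ιP)
    (hS : ContMDiff (𝓡 s) (𝓡 p) ω ιS) (hj : ContMDiff (𝓡 s) 𝓘(ℝ, CModel s) ω j)
    (hκ : ContMDiff 𝓘(ℂ, CModel s) 𝓘(ℂ, CModel n) ω κ) (hκj : ∀ x, κ (j x) = ιP (ιS x))
    (hA : ∀ x, Function.Bijective (cplx (realDifferential s s j x)))
    (hB : ∀ x, Function.Bijective (cplx (realDifferential p n ιP (ιS x))))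
    {F : S → MixedTensor ℝ (RModel s) (RModel p) a b c d} {x₀ : S}
    (hF : IsAnalyticTensorAt ιS F x₀) :
    ∃ D : X → MixedTensor ℂ (CModel s) (CModel n) a b c d,
      (∀ᶠ z in 𝓝 (j x₀), IsAnalyticTensorAt κ D z) ∧
      ∀ᶠ x in 𝓝 x₀, ExtendsTensor (realDifferential s s j x)
        (realDifferential p n ιP (ιS x)) (D (j x)) (F x) := by
  have := isManifold_real (CModel n) M
  have := isManifold_real (CModel s) X
  set z₀ := j x₀ with hz₀
  set y₀ := ιP (ιS x₀) with hy₀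
  obtain ⟨𝒜, h𝒜, h𝒜j⟩ := exists_invertible_extension (hj x₀) (hA x₀).1
    (contMDiffAt_cplx_inCoord (i := fun x : S => x) (x₀ := x₀) (hj x₀) contMDiffAt_id)
    (by simpa only [inCoord_self] using hA x₀)
  obtain ⟨ℬ, hℬ, hℬj⟩ := exists_invertible_extension (X := X) (hj x₀) (hA x₀).1
    (contMDiffAt_cplx_inCoord (hP (ιS x₀)) (hS x₀))
    (by simpa only [inCoord_self] using hB x₀)
  have hC (I : TensorIndex (Fin s) (Fin p) a b c d) := exists_holomorphic_extension_of_totallyReal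
    (X := X) (E := ℂ) (hj x₀) (hA x₀).1 (h := fun x => ((F x
      (fun i => ofCoord ℝ x₀ x (EuclideanSpace.single (I.1 i) 1))
      (fun i => (EuclideanSpace.proj (I.2.1 i) : RModel s →L[ℝ] ℝ).toLinearMap.comp
        (toCoord ℝ x₀ x).toLinearMap)
      (fun i => ofCoord ℝ (ιS x₀) (ιS x) (EuclideanSpace.single (I.2.2.1 i) 1))
      (fun i => (EuclideanSpace.proj (I.2.2.2 i) : RModel p →L[ℝ] ℝ).toLinearMap.comp
        (toCoord ℝ (ιS x₀) (ιS x)).toLinearMap) : ℝ) : ℂ))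
    (Complex.ofRealCLM.contMDiff.contMDiffAt.comp x₀ (hF _ _ _ _))
  choose C hCa hCj using hC
  refine ⟨fun z => ∑ I : TensorIndex (Fin s) (Fin p) a b c d, C I z • elemTensor
    (fun t => ((EuclideanSpace.proj (I.1 t) : CModel s →L[ℂ] ℂ).comp
      ((𝒜 z).inverse.comp (toCoord ℂ z₀ z))).toLinearMap)
    (fun t => ofCoord ℂ z₀ z (𝒜 z (EuclideanSpace.single (I.2.1 t) 1)))
    (fun t => ((EuclideanSpace.proj (I.2.2.1 t) : CModel p →L[ℂ] ℂ).comp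
      ((ℬ z).inverse.comp (toCoord ℂ y₀ (κ z)))).toLinearMap)
    (fun t => ofCoord ℂ y₀ (κ z) (ℬ z (EuclideanSpace.single (I.2.2.2 t) 1))), ?_, ?_⟩
  · have hκy : ∀ᶠ z in 𝓝 z₀, κ z ∈ (chartAt (CModel n) y₀).source := by
      refine hκ.continuous.continuousAt.eventually ((chartAt (CModel n) y₀).open_source.mem_nhds ?_)
      rw [hz₀, hκj]
      exact mem_chart_source _ _
    have hC' : ∀ᶠ z in 𝓝 z₀, ∀ I, ContMDiffAt 𝓘(ℂ, CModel s) 𝓘(ℂ, ℂ) ω (C I) z :=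
      eventually_all.2 fun I => (contMDiffAt_iff_contMDiffAt_nhds (by simp)).1 (hCa I)
    filter_upwards [h𝒜, hℬ, hC', hκy,
      (chartAt (CModel s) z₀).open_source.mem_nhds (mem_chart_source _ z₀)] with z hz1 hz2 hz3 hz4 hz5
    exact isAnalyticTensorAt_sum
      (ε := fun i z => ((EuclideanSpace.proj i : CModel s →L[ℂ] ℂ).comp
        ((𝒜 z).inverse.comp (toCoord ℂ z₀ z))).toLinearMap)
      (w := fun i z => ofCoord ℂ z₀ z (𝒜 z (EuclideanSpace.single i 1)))
      (η := fun i z => ((EuclideanSpace.proj i : CModel p →L[ℂ] ℂ).comp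
        ((ℬ z).inverse.comp (toCoord ℂ y₀ (κ z)))).toLinearMap)
      (h := fun i z => ofCoord ℂ y₀ (κ z) (ℬ z (EuclideanSpace.single i 1)))
      hz3
      (fun i u => contMDiffAt_coframe (f := id) contMDiffAt_id hz5 hz1.2.1
        (EuclideanSpace.proj i) u)
      (fun i l => contMDiffAt_frame (f := id) contMDiffAt_id hz5 hz1.1 l _)
      (fun i u => contMDiffAt_coframe hκ.contMDiffAt hz4 hz2.2.1 (EuclideanSpace.proj i) u)
      (fun i l => contMDiffAt_frame hκ.contMDiffAt hz4 hz2.1 l _)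
  · have hjc := (hj x₀).continuousAt
    have hSc := (hS x₀).continuousAt
    have hPc : ContinuousAt (fun x => ιP (ιS x)) x₀ := (hP.continuous.comp hS.continuous).continuousAt
    filter_upwards [h𝒜j, hℬj, eventually_all.2 hCj, hjc.eventually h𝒜, hjc.eventually hℬ,
      (chartAt (RModel s) x₀).open_source.mem_nhds (mem_chart_source _ x₀),
      hSc.eventually ((chartAt (RModel p) (ιS x₀)).open_source.mem_nhds (mem_chart_source _ _)),
      hjc.eventually ((chartAt (CModel s) z₀).open_source.mem_nhds (mem_chart_source _ _)),
      hPc.eventually ((chartAt (CModel n) y₀).open_source.mem_nhds (mem_chart_source _ _))]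
      with x hx1 hx2 hx3 hx4 hx5 hxS hxP hxX hxM
    intro u l v m L N hL hN
    -- At `j x` the extended frames are the images of the real coordinate frames and the coframes
    -- restrict to the real coordinate forms. The four side goals express this on vectors and
    -- covectors.
    have key := sum_elemTensor_eq_ofReal (frameBasis hxS) (frameBasis hxP) (F x)
      (fun i => ((EuclideanSpace.proj i : CModel s →L[ℂ] ℂ).comp
        ((𝒜 (j x)).inverse.comp (toCoord ℂ z₀ (j x)))).toLinearMap)
      (fun i => ofCoord ℂ z₀ (j x) (𝒜 (j x) (EuclideanSpace.single i 1)))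
      (fun i => ((EuclideanSpace.proj i : CModel p →L[ℂ] ℂ).comp
        ((ℬ (j x)).inverse.comp (toCoord ℂ y₀ (κ (j x))))).toLinearMap)
      (fun i => ofCoord ℂ y₀ (κ (j x)) (ℬ (j x) (EuclideanSpace.single i 1)))
      (u := u) (l := l) (v := v) (m := m)
      (u' := fun i => realDifferential s s j x (u i)) (l' := L)
      (v' := fun i => realDifferential p n ιP (ιS x) (v i)) (m' := N)
      (fun i t => ?_) (fun i t => ?_) (fun i t => ?_) (fun i t => ?_)
    · rw [← key]
      refine congrArg (fun T : MixedTensor ℂ (CModel s) (CModel n) a b c d => T _ L _ N)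
        (Finset.sum_congr rfl fun I _ => ?_)
      rw [hx3 I]
      simp only [MixedTensor.component, frameBasis_apply, frameBasis_coord]
    · have h1 := toCoord_eq_cplx_inCoord (T := realDifferential s s j x) hxS hxX (u t)
      simp only [ContinuousLinearMap.coe_coe, ContinuousLinearMap.comp_apply, h1]
      rw [show cplx (inCoord x₀ x z₀ (j x) (realDifferential s s j x)) = 𝒜 (j x) from hx1.symm,
        hx4.2.2, frameBasis_coord]
      simp
    · rw [hx1, single_eq_realIncl, frameBasis_apply, ← hL]
      exact congrArg (L t) (ofCoord_cplx_inCoord (T := realDifferential s s j x) hxX _)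
    · have h1 := toCoord_eq_cplx_inCoord (T := realDifferential p n ιP (ιS x)) hxP hxM (v t)
      simp only [ContinuousLinearMap.coe_coe, ContinuousLinearMap.comp_apply, hκj, h1]
      rw [show cplx (inCoord (ιS x₀) (ιS x) y₀ (ιP (ιS x)) (realDifferential p n ιP (ιS x))) =
        ℬ (j x) from hx2.symm, hx5.2.2, frameBasis_coord]
      simp
    · rw [hx2, single_eq_realIncl, frameBasis_apply, ← hN, hκj]
      exact congrArg (N t) (ofCoord_cplx_inCoord (T := realDifferential p n ιP (ιS x)) hxM _)

end Local

/-! ### Uniqueness of germs of holomorphic extensions -/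

section Unique

variable {s p n : ℕ} {a b c d : ℕ}
  {S : Type*} [TopologicalSpace S] [ChartedSpace (RModel s) S]
  {P : Type*} [TopologicalSpace P] [ChartedSpace (RModel p) P]
  {X : Type*} [TopologicalSpace X] [ChartedSpace (CModel s) X] [IsManifold 𝓘(ℂ, CModel s) ω X]
  {M : Type*} [TopologicalSpace M] [ChartedSpace (CModel n) M] [IsManifold 𝓘(ℂ, CModel n) ω M]
  {ιS : S → P} {ιP : P → M} {j : S → X} {κ : X → M}

/-- The germ of a holomorphic extension is unique. -/
theorem eventuallyEq_of_extendsTensor (hj : ContMDiff (𝓡 s) 𝓘(ℝ, CModel s) ω j)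
    (hκ : ContMDiff 𝓘(ℂ, CModel s) 𝓘(ℂ, CModel n) ω κ)
    (hA : ∀ x, Function.Bijective (cplx (realDifferential s s j x)))
    (hB : ∀ x, Function.Bijective (cplx (realDifferential p n ιP (ιS x))))
    {F : S → MixedTensor ℝ (RModel s) (RModel p) a b c d} {x : S}
    {D D' : X → MixedTensor ℂ (CModel s) (CModel n) a b c d}
    (hD : IsAnalyticTensorAt κ D (j x)) (hD' : IsAnalyticTensorAt κ D' (j x))
    (h : ∀ᶠ y in 𝓝 x, ExtendsTensor (realDifferential s s j y)
      (realDifferential p n ιP (ιS y)) (D (j y)) (F y))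
    (h' : ∀ᶠ y in 𝓝 x, ExtendsTensor (realDifferential s s j y)
      (realDifferential p n ιP (ιS y)) (D' (j y)) (F y)) : D =ᶠ[𝓝 (j x)] D' := by
  obtain ⟨ι, _, g, hg, hg0, hgD⟩ := (hD.sub hD').exists_components hκ.continuous.continuousAt
  -- By uniqueness at each real point the difference vanishes along `j`, so its holomorphic
  -- components vanish near `j x`.
  have h0 : ∀ i, ∀ᶠ z in 𝓝 (j x), g i z = 0 := fun i => by
    refine eventually_eq_zero_of_totallyReal (hj x) (hA x).1 (hg i) ?_
    filter_upwards [h, h'] with y hy hy'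
    refine hg0 i _ ?_
    rw [hy.unique (hA y) (hB y) hy']
    ext
    simp
  filter_upwards [hgD, eventually_all.2 h0] with z hz hz0
  exact MixedTensor.eq_of_add_neg_smul_eq_zero (hz hz0)

end Unique

/-! ### Restriction to open subsets -/

section Opens

variable {𝕜 : Type*} [NontriviallyNormedField 𝕜]
  {A : Type*} [NormedAddCommGroup A] [NormedSpace 𝕜 A]
  {X : Type*} [TopologicalSpace X] [ChartedSpace A X]
  {U : TopologicalSpace.Opens X}

/-- In the charts of `U` and `X` at a point of `U`, the inclusion is the identity. -/
lemma hasMFDerivAt_subtypeVal (y : U) :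
    HasMFDerivAt 𝓘(𝕜, A) 𝓘(𝕜, A) (Subtype.val : U → X) y (ContinuousLinearMap.id 𝕜 A) := by
  refine ⟨continuous_subtype_val.continuousAt, ?_⟩
  refine HasFDerivAt.hasFDerivWithinAt ?_
  refine (hasFDerivAt_id _).congr_of_eventuallyEq ?_
  filter_upwards [(chartAt A y).open_target.mem_nhds (mem_chart_target A y)] with w hw
  have h1 : ((chartAt A y).symm w : X) = (chartAt A (y : X)).symm w :=
    (chartAt A (y : X)).subtypeRestr_symm_apply ⟨y⟩ hw
  simp only [mfld_simps, h1]
  exact (chartAt A (y : X)).right_inv hw.1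

variable [IsManifold 𝓘(𝕜, A) ω X]

/-- The chart of `U` is the chart of `X` composed with the inclusion, whose differential is the
identity. -/
lemma toCoord_opens {y₀ y : U} (h : y ∈ (chartAt A y₀).source) :
    toCoord (A := A) 𝕜 y₀ y = toCoord (A := A) 𝕜 (y₀ : X) (y : X) := by
  have h' : (y : X) ∈ (chartAt A (y₀ : X)).source := h.2
  have h1 := TangentBundle.continuousLinearMapAt_trivializationAt (I := 𝓘(𝕜, A)) h
  have h2 := TangentBundle.continuousLinearMapAt_trivializationAt (I := 𝓘(𝕜, A)) h'
  refine Eq.trans h1 (Eq.trans ?_ h2.symm)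
  have h3 := (mdifferentiableAt_extChartAt (I := 𝓘(𝕜, A)) h').hasMFDerivAt
  exact (h3.comp y (hasMFDerivAt_subtypeVal y)).mfderiv

lemma ofCoord_opens {y₀ y : U} (h : y ∈ (chartAt A y₀).source) :
    ofCoord (A := A) 𝕜 y₀ y = ofCoord (A := A) 𝕜 (y₀ : X) (y : X) := by
  have h' : (y : X) ∈ (chartAt A (y₀ : X)).source := h.2
  ext1 v
  have h1 := toCoord_ofCoord (𝕜 := 𝕜) h v
  rw [toCoord_opens h] at h1
  rw [← ofCoord_toCoord (𝕜 := 𝕜) h' (ofCoord (A := A) 𝕜 y₀ y v), h1]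

variable {B : Type*} [NormedAddCommGroup B] [NormedSpace 𝕜 B]
  {Y : Type*} [TopologicalSpace Y] [ChartedSpace B Y] [IsManifold 𝓘(𝕜, B) ω Y]
  {a b c d : ℕ} {f : X → Y}

lemma IsAnalyticTensorAt.restrict {D : X → MixedTensor 𝕜 A B a b c d} {y : U}
    (h : IsAnalyticTensorAt f D y) :
    IsAnalyticTensorAt (fun z : U => f z) (fun z : U => D z) y := by
  intro u l v m
  refine ((h u l v m).comp y contMDiff_subtype_val.contMDiffAt).congr_of_eventuallyEq ?_
  filter_upwards [(chartAt A y).open_source.mem_nhds (mem_chart_source A y)] with z hz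
  rw [toCoord_opens hz, ofCoord_opens hz]
  rfl

end Opens

lemma realDifferential_subtypeVal {q m : ℕ} {Q : Type*} [TopologicalSpace Q]
    [ChartedSpace (RModel q) Q] {X : Type*} [TopologicalSpace X] [ChartedSpace (CModel m) X]
    {U : TopologicalSpace.Opens X} {j : Q → U} {x : Q}
    (hj : MDifferentiableAt (𝓡 q) 𝓘(ℝ, CModel m) j x) :
    realDifferential q m (fun y => (j y : X)) x = realDifferential q m j x :=
  ((hasMFDerivAt_subtypeVal (j x)).comp x hj.hasMFDerivAt).mfderiv

/-! ### Complexifications and holomorphic extensions -/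

/-- A point of `Q` forces `q ≤ m`, so that `m - q` is the true codimension. If `Q` is empty this may
fail, and the empty subset serves. -/
theorem exists_isSliced_mem {q m : ℕ} {Q : Type*} [TopologicalSpace Q] [ChartedSpace (RModel q) Q]
    {M : Type*} [TopologicalSpace M] [ChartedSpace (CModel m) M] [IsManifold (𝓡 q) ω Q]
    [IsManifold 𝓘(ℂ, CModel m) ω M] [TopologicalSpace.MetrizableSpace M] {f : Q → M}
    (hf : IsTotallyRealEmbedding q m f) :
    ∃ (r : ℕ) (X : Set M), IsSliced q r m X ∧ ∀ x, f x ∈ X := by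
  rcases isEmpty_or_nonempty Q with hQ | ⟨⟨x⟩⟩
  · exact ⟨0, ∅, fun z hz => hz.elim, fun x => hQ.elim x⟩
  · exact ⟨m - q, exists_isSliced (Nat.add_sub_of_le (hf.le f x)) hf⟩

lemma IsComplexification.bijective_cplx {s m : ℕ}
    {S : Type*} [TopologicalSpace S] [ChartedSpace (RModel s) S] [IsManifold (𝓡 s) ω S]
    {X : Type*} [TopologicalSpace X] [ChartedSpace (CModel s) X] [IsManifold 𝓘(ℂ, CModel s) ω X]
    {M : Type*} [TopologicalSpace M] [ChartedSpace (CModel m) M]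
    {f : S → M} {j : S → X} {κ : X → M} (h : IsComplexification s m f j κ) (x : S) :
    Function.Bijective (cplx (realDifferential s s j x)) := by
  have := isManifold_real (CModel s) X
  exact ⟨cplx_injective (injective_mfderiv_of_isSmoothEmbedding h.isAnalyticEmbedding x)
    (h.isTotallyReal x), cplx_surjective (h.isGeneric x)⟩

/-- By the chain rule the tangent image of the composite lies in that of `g`, and total reality
passes to subspaces. -/
lemma isTotallyRealEmbedding_comp {q s m : ℕ}
    {Q : Type*} [TopologicalSpace Q] [ChartedSpace (RModel q) Q] [IsManifold (𝓡 q) ω Q]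
    {S : Type*} [TopologicalSpace S] [ChartedSpace (RModel s) S] [IsManifold (𝓡 s) ω S]
    {M : Type*} [TopologicalSpace M] [ChartedSpace (CModel m) M] [IsManifold 𝓘(ℂ, CModel m) ω M]
    {f : Q → S} {g : S → M} (hg : Manifold.IsSmoothEmbedding (𝓡 s) 𝓘(ℝ, CModel m) ω g)
    (hgt : ∀ x, IsTotallyReal (tangentImage s m g x))
    (hf : Manifold.IsSmoothEmbedding (𝓡 q) (𝓡 s) ω f) :
    IsTotallyRealEmbedding q m fun y => g (f y) := by
  have := isManifold_real (CModel m) M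
  refine isTotallyRealEmbedding_of_isSmoothEmbedding (isSmoothEmbedding_comp hg hf) fun y =>
    (hgt (f y)).mono ?_
  rintro _ ⟨v, rfl⟩
  have h := mfderiv_comp y (hg.contMDiff.mdifferentiableAt (x := f y) (by simp))
    (hf.contMDiff.mdifferentiableAt (x := y) (by simp))
  exact ⟨mfderiv (𝓡 q) (𝓡 s) f y v, (congrArg (fun T : RModel q →L[ℝ] CModel m => T v) h).symm⟩

section

variable {s p n : ℕ} {a b c d : ℕ}
  {S : Type*} [TopologicalSpace S] [ChartedSpace (RModel s) S] [IsManifold (𝓡 s) ω S]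
  {P : Type*} [TopologicalSpace P] [ChartedSpace (RModel p) P] [IsManifold (𝓡 p) ω P]
  {ιS : S → P}

/-- Near a totally real submanifold of full dimension, a real-analytic tensor field has a
holomorphic extension. -/
theorem exists_extension_near
    {X : Type*} [TopologicalSpace X] [ChartedSpace (CModel s) X] [IsManifold 𝓘(ℂ, CModel s) ω X]
    [TopologicalSpace.MetrizableSpace X]
    {M : Type*} [TopologicalSpace M] [ChartedSpace (CModel n) M] [IsManifold 𝓘(ℂ, CModel n) ω M]
    {ιP : P → M} {j : S → X} {κ : X → M}
    (hP : ContMDiff (𝓡 p) 𝓘(ℝ, CModel n) ω ιP) (hS : ContMDiff (𝓡 s) (𝓡 p) ω ιS)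
    (hX : IsComplexification s n (fun x => ιP (ιS x)) j κ)
    (hB : ∀ x, Function.Bijective (cplx (realDifferential p n ιP (ιS x))))
    {F : S → MixedTensor ℝ (RModel s) (RModel p) a b c d}
    (hF : ∀ x, IsAnalyticTensorAt ιS F x) :
    ∃ (O : TopologicalSpace.Opens X) (G : X → MixedTensor ℂ (CModel s) (CModel n) a b c d),
      (∀ z ∈ O, IsAnalyticTensorAt κ G z) ∧ ∀ x, j x ∈ O ∧
        ExtendsTensor (realDifferential s s j x) (realDifferential p n ιP (ιS x))
          (G (j x)) (F x) := by
  have hA := hX.bijective_cplx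
  have hj := hX.isAnalyticEmbedding.contMDiff
  have hκ := hX.isHolomorphicEmbedding.contMDiff
  choose D hD hDF using fun x =>
    exists_local_extension hP hS hj hκ hX.comp_eq hA hB (hF x)
  have hU (x : S) : ∃ U : Set X, IsOpen U ∧ j x ∈ U ∧ (∀ z ∈ U, IsAnalyticTensorAt κ (D x) z) ∧
      ∀ y, j y ∈ U → ExtendsTensor (realDifferential s s j y)
        (realDifferential p n ιP (ιS y)) (D x (j y)) (F y) := by
    have h1 := hDF x
    rw [hX.isAnalyticEmbedding.isEmbedding.isInducing.nhds_eq_comap, eventually_comap] at h1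
    obtain ⟨U, hU, hUo, hxU⟩ := eventually_nhds_iff.1 ((hD x).and h1)
    exact ⟨U, hUo, hxU, fun z hz => (hU z hz).1, fun y hy => (hU _ hy).2 y rfl⟩
  choose U hUo hxU hUD hUF using hU
  have hev (x y : S) (hy : j y ∈ U x) : ∀ᶠ y' in 𝓝 y, ExtendsTensor (realDifferential s s j y')
      (realDifferential p n ιP (ιS y')) (D x (j y')) (F y') :=
    (hj.continuous.continuousAt.eventually ((hUo x).mem_nhds hy)).mono (hUF x)
  -- Two local extensions defined at the same point of `j` have the same germ there by
  -- `eventuallyEq_of_extendsTensor`, which is the compatibility required for gluing.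
  obtain ⟨O, hO, hjO, G, hG⟩ := exists_glued_germ (Set.range j) U hUo
    (by rintro _ ⟨x, rfl⟩; exact Set.mem_iUnion.2 ⟨x, hxU x⟩) D
    (by
      rintro x x' _ ⟨y, rfl⟩ hy hy'
      exact eventuallyEq_of_extendsTensor hj hκ hA hB (hUD x _ hy) (hUD x' _ hy')
        (hev x y hy) (hev x' y hy'))
  refine ⟨⟨O, hO⟩, G, fun z hz => ?_, fun x => ⟨hjO ⟨x, rfl⟩, ?_⟩⟩
  · obtain ⟨x, hx, hxG⟩ := hG z hz
    exact (hUD x z hx).congr hxG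
  · obtain ⟨x', hx', hxG⟩ := hG (j x) (hjO ⟨x, rfl⟩)
    rw [hxG.self_of_nhds]
    exact hUF x' x hx'

variable {M : Type u} [TopologicalSpace M] [ChartedSpace (CModel n) M]
  [IsManifold 𝓘(ℂ, CModel n) ω M]

/-- A complexification `Y` obtained by gluing slices may be too large to carry the extension, so it
is replaced by the open neighbourhood `O` of `S` on which the glued tensor field is holomorphic. -/
theorem exists_complexification_extends [TopologicalSpace.MetrizableSpace M] {ιP : P → M}
    (hP : ContMDiff (𝓡 p) 𝓘(ℝ, CModel n) ω ιP) (hS : ContMDiff (𝓡 s) (𝓡 p) ω ιS)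
    (hf : IsTotallyRealEmbedding s n fun x => ιP (ιS x))
    (hB : ∀ x, Function.Bijective (cplx (realDifferential p n ιP (ιS x))))
    (F : TensorFieldAlong ℝ (RModel s) (RModel p) ιS a b c d) (hF : F.IsAnalytic) :
    ∃ (X : Type u) (_ : TopologicalSpace X) (_ : ChartedSpace (CModel s) X)
      (_ : IsManifold 𝓘(ℂ, CModel s) ω X) (j : S → X) (κ : X → M)
      (G : TensorFieldAlong ℂ (CModel s) (CModel n) κ a b c d),
      IsComplexification s n (fun x => ιP (ιS x)) j κ ∧ G.IsAnalytic ∧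
        Extends s n p ιP j G F := by
  obtain ⟨r, Y, hY, hfY⟩ := exists_isSliced_mem hf
  let := hY.chartedSpace
  have := hY.isManifold
  have : TopologicalSpace.MetrizableSpace Y := IsEmbedding.subtypeVal.metrizableSpace
  let j₁ (x : S) : Y := ⟨ιP (ιS x), hfY x⟩
  have h₁ : IsComplexification s n (fun x => ιP (ιS x)) j₁ Subtype.val :=
    isComplexification_of_isSmoothEmbedding hf hY.isSmoothEmbedding_val fun _ => rfl
  obtain ⟨O, G, hG, hGF⟩ := exists_extension_near hP hS h₁ hB hF
  let j (x : S) : O := ⟨j₁ x, (hGF x).1⟩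
  have h : IsComplexification s n (fun x => ιP (ιS x)) j (fun z : O => ((z : Y) : M)) :=
    isComplexification_of_isSmoothEmbedding hf
      (isSmoothEmbedding_comp hY.isSmoothEmbedding_val (Manifold.IsSmoothEmbedding.of_opens O))
      fun _ => rfl
  refine ⟨O, inferInstance, inferInstance, inferInstance, j, fun z => ((z : Y) : M),
    fun z => G z, h, fun z => (hG z z.2).restrict, fun x => ?_⟩
  -- Passing to an open subset leaves the differential unchanged, so the extension property
  -- transfers as it stands.
  have h2 : realDifferential s s j₁ x = realDifferential s s j x :=
    realDifferential_subtypeVal (h.isAnalyticEmbedding.contMDiff.mdifferentiableAt (by simp))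
  have h3 := (hGF x).2
  rw [h2] at h3
  exact h3

/-- In a complexification `Y ⊂ X` of `Q` the submanifold `Q` has full real dimension, so the
identity theorem applies to the restrictions to `Y` of the components of `G`. -/
theorem exists_complexification_eq_zero {X : Type u} [TopologicalSpace X]
    [ChartedSpace (CModel s) X] [IsManifold 𝓘(ℂ, CModel s) ω X]
    [TopologicalSpace.MetrizableSpace X] {κ : X → M}
    (hκ : Manifold.IsSmoothEmbedding 𝓘(ℂ, CModel s) 𝓘(ℂ, CModel n) ω κ)
    {q : ℕ} {Q : Type*} [TopologicalSpace Q] [ChartedSpace (RModel q) Q] [IsManifold (𝓡 q) ω Q]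
    {f : Q → X} (hf : IsTotallyRealEmbedding q s f)
    {G : TensorFieldAlong ℂ (CModel s) (CModel n) κ a b c d} (hG : G.IsAnalytic)
    (hGf : ∀ y, G (f y) = 0) :
    ∃ (N : Type u) (_ : TopologicalSpace N) (_ : ChartedSpace (CModel q) N)
      (_ : IsManifold 𝓘(ℂ, CModel q) ω N) (jN : Q → N) (ν : N → X),
      IsComplexification q s f jN ν ∧
      IsComplexification q n (fun y => κ (f y)) jN (fun z => κ (ν z)) ∧ ∀ z, G (ν z) = 0 := by
  obtain ⟨r, Y, hY, hfY⟩ := exists_isSliced_mem hf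
  let := hY.chartedSpace
  have := hY.isManifold
  let j₁ (y : Q) : Y := ⟨f y, hfY y⟩
  have h₁ : IsComplexification q s f j₁ Subtype.val :=
    isComplexification_of_isSmoothEmbedding hf hY.isSmoothEmbedding_val fun _ => rfl
  -- The interior is taken in `Y`, not in `X`, where the zero set of `G` may have empty interior.
  let O : TopologicalSpace.Opens Y := ⟨interior {z | G z = 0}, isOpen_interior⟩
  have hO (y : Q) : j₁ y ∈ O := by
    refine mem_interior_iff_mem_nhds.2 ?_
    obtain ⟨ι, _, g, hg, hg0, hgG⟩ :=
      (isAnalytic_iff.1 hG (f y)).exists_components hκ.contMDiff.continuous.continuousAt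
    have h0 : ∀ i, ∀ᶠ z : Y in 𝓝 (j₁ y), g i z = 0 := fun i => by
      refine eventually_eq_zero_of_totallyReal (h := fun z : Y => g i (z : X))
        (h₁.isAnalyticEmbedding.contMDiff y) (h₁.bijective_cplx y).1
        (ContMDiffAt.comp (j₁ y) (g := g i) (hg i) (hY.isSmoothEmbedding_val.contMDiff _)) ?_
      exact Eventually.of_forall fun y' => hg0 i _ (hGf y')
    have h1 : ∀ᶠ z : Y in 𝓝 (j₁ y), (∀ i, g i z = 0) → G z = 0 :=
      (continuous_subtype_val.continuousAt (x := j₁ y)).eventually hgG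
    filter_upwards [h1, eventually_all.2 h0] with z hz hz0
    exact hz hz0
  let j (y : Q) : O := ⟨j₁ y, hO y⟩
  have hν : Manifold.IsSmoothEmbedding 𝓘(ℂ, CModel q) 𝓘(ℂ, CModel s) ω
      (fun z : O => ((z : Y) : X)) :=
    isSmoothEmbedding_comp hY.isSmoothEmbedding_val (Manifold.IsSmoothEmbedding.of_opens O)
  have h : IsComplexification q s f j (fun z : O => ((z : Y) : X)) :=
    isComplexification_of_isSmoothEmbedding hf hν fun _ => rfl
  exact ⟨O, inferInstance, inferInstance, inferInstance, j, fun z => ((z : Y) : X), h,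
    ⟨isSmoothEmbedding_comp hκ hν, h.isAnalyticEmbedding, fun _ => rfl, h.isTotallyReal,
      h.isGeneric⟩, fun z => (interior_subset z.2 : _)⟩

end

end HolRiem

end

/-! ### The vanishing theorem for holomorphic extensions -/

theorem mainTheorem4 {n p s q : ℕ}
    {M : Type u} [TopologicalSpace M] [T2Space M] [SecondCountableTopology M]
    [ChartedSpace (CModel n) M] [IsManifold 𝓘(ℂ, CModel n) ω M] (g : HolomorphicMetric n M)
    {P : Type*} [TopologicalSpace P] [ChartedSpace (RModel p) P] [IsManifold (𝓡 p) ω P]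
    (ιP : P → M) (hP : IsGenericRealSlice p g ιP)
    {S : Type*} [TopologicalSpace S] [ChartedSpace (RModel s) S] [IsManifold (𝓡 s) ω S]
    (ιS : S → P) (hS : Manifold.IsSmoothEmbedding (𝓡 s) (𝓡 p) ω ιS)
    {Q : Type*} [TopologicalSpace Q] [ChartedSpace (RModel q) Q] [IsManifold (𝓡 q) ω Q]
    (ιQ : Q → S) (hQ : Manifold.IsSmoothEmbedding (𝓡 q) (𝓡 s) ω ιQ)
    (hQg : ∀ y : Q, IsNondegenerateOn (g.at (ιP (ιS (ιQ y))))
      (tangentImage q n (fun z : Q => ιP (ιS (ιQ z))) y))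
    {a b c d : ℕ} (F : TensorFieldAlong ℝ (RModel s) (RModel p) ιS a b c d)
    (hF : F.IsAnalytic) (hFQ : ∀ y : Q, F (ιQ y) = 0) :
    (∃ (X : Type u) (_ : TopologicalSpace X) (_ : ChartedSpace (CModel s) X)
      (_ : IsManifold 𝓘(ℂ, CModel s) ω X) (j : S → X) (κ : X → M)
      (G : TensorFieldAlong ℂ (CModel s) (CModel n) κ a b c d),
      IsComplexification s n (fun x => ιP (ιS x)) j κ ∧ G.IsAnalytic ∧ Extends s n p ιP j G F) ∧
    ∀ (X : Type u) [TopologicalSpace X] [ChartedSpace (CModel s) X]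
      [IsManifold 𝓘(ℂ, CModel s) ω X] (j : S → X) (κ : X → M)
      (G : TensorFieldAlong ℂ (CModel s) (CModel n) κ a b c d),
      IsComplexification s n (fun x => ιP (ιS x)) j κ → G.IsAnalytic → Extends s n p ιP j G F →
      ∃ (N : Type u) (_ : TopologicalSpace N) (_ : ChartedSpace (CModel q) N)
        (_ : IsManifold 𝓘(ℂ, CModel q) ω N) (jN : Q → N) (ν : N → X),
        IsComplexification q s (fun y => j (ιQ y)) jN ν ∧
        IsComplexification q n (fun y => ιP (ιS (ιQ y))) jN (fun z => κ (ν z)) ∧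
        ∀ z : N, G (ν z) = 0 := by
  have : TopologicalSpace.MetrizableSpace M := metrizableSpace_of_chartedSpace n M
  have := isManifold_real (CModel n) M
  have hPt (x : P) : IsTotallyReal (tangentImage p n ιP x) := (hP.isRealSlice x).isTotallyReal
  have hB (x : S) : Function.Bijective (cplx (realDifferential p n ιP (ιS x))) :=
    ⟨cplx_injective (injective_mfderiv_of_isSmoothEmbedding hP.isAnalyticEmbedding _) (hPt _),
      cplx_surjective (hP.isGeneric _)⟩
  refine ⟨exists_complexification_extends hP.isAnalyticEmbedding.contMDiff hS.contMDiff
    (isTotallyRealEmbedding_comp hP.isAnalyticEmbedding hPt hS) hB F hF, ?_⟩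
  intro X _ _ _ j κ G hX hG hGF
  -- An arbitrary complexification is metrizable because `κ` embeds it in `M`.
  have : TopologicalSpace.MetrizableSpace X :=
    hX.isHolomorphicEmbedding.isEmbedding.metrizableSpace
  obtain ⟨N, h1, h2, h3, jN, ν, h4, h5, h6⟩ := exists_complexification_eq_zero
    hX.isHolomorphicEmbedding (isTotallyRealEmbedding_comp hX.isAnalyticEmbedding
      hX.isTotallyReal hQ) hG fun y => by
        -- At a point of `Q` both `G` and the zero tensor extend `F = 0`, so they coincide.
        have h : ExtendsTensor (realDifferential s s j (ιQ y))
            (realDifferential p n ιP (ιS (ιQ y))) (G (j (ιQ y))) (F (ιQ y)) := hGF (ιQ y)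
        rw [hFQ y] at h
        exact h.unique (hX.bijective_cplx _) (hB _) (extendsTensor_zero _ _)
  simp only [hX.comp_eq] at h5
  exact ⟨N, h1, h2, h3, jN, ν, h4, h5, h6⟩
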